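/- **Setting.** Let $M$ be a smooth finite-dimensional (Hausdorff, second countable) manifold without boundary and $\omega\in\Omega^3(M)$ a 2-plectic form, i.e. $d\omega=0$ and $u\mapsto\iota_u\omega$ is injective on $TM$. A 1-form $\alpha$ is Hamiltonian if $d\alpha=-\iota_{v_\alpha}\omega$ for some vector field $v_\alpha$. Let $\mathfrak g$ be a finite-dimensional real Lie algebra and $\mathfrak g\to\mathfrak X(M)$, $x\mapsto v_x$, a Lie algebra morphism such that every $v_x$ is the Hamiltonian vector field of some 1-form. Let $L=\mathfrak h[1]\oplus\mathfrak g$ be a finite-dimensional minimal Lie 2-algebra extending $\mathfrak g$, i.e. a finite-dimensional $\mathfrak g$-module $\mathfrak h$ (binary bracket $[x,h]$, $[h,x]=-[x,h]$) with a 3-cocycle $[\cdot,\cdot,\cdot]\colon\Lambda^3\mathfrak g\to\mathfrak h$. Fix $p\in M$. *Moment maps.* $L_\infty(M,\omega)$ is the Lie 2-algebra with $\Omega^1_{\rm Ham}(M)$ in degree $0$, $C^\infty(M)$ in degree $-1$, unary bracket $d$, $[\alpha,\beta]'=\iota_{v_\beta}\iota_{v_\alpha}\omega$ and $[\alpha,\beta,\gamma]'=-\iota_{v_\gamma}\iota_{v_\beta}\iota_{v_\alpha}\omega$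 on Hamiltonian 1-forms (all other brackets being zero). A moment map for $L$ is an $L_\infty$-morphism $L\to L_\infty(M,\omega)$ such that $d(f_1(x))=-\iota_{v_x}\omega$ for $x\in\mathfrak g$; that is, it consists of linear maps $f_1\colon\mathfrak g\to\Omega^1_{\rm Ham}(M)$, $f_1\colon\mathfrak h\to C^\infty(M)$, $f_2\colon\Lambda^2\mathfrak g\to C^\infty(M)$ with, for all $x,y,z\in\mathfrak g$ and $h\in\mathfrak h$, $$d(f_1(x))=-\iota_{v_x}\omega,\qquad d(f_1(h))=0,\qquad d(f_2(x,y))=f_1([x,y])-[f_1(x),f_1(y)]',\qquad f_1([h,x])=0,$$ $$f_1([x,y,z])-[f_1(x),f_1(y),f_1(z)]'=f_2(x,[y,z])-f_2(y,[x,z])+f_2(z,[x,y]).$$ *Complexes.* Let $CE(L)=\big(S^{\ge1}(\mathfrak h[2]\oplus\mathfrak g[1])^*,\,d_{CE(L)}=-d_2+d_3\big)$ be the Chevalley–Eilenberg complex, where $(d_i\xi)(x_1\cdots x_n)=\sum_{\sigma\in Sh(i,n-i)}\epsilon(\sigma)\,\xi\big(l_i(x_{\sigma(1)},\dots,x_{\sigma(i)})\,x_{\sigma(i+1)}\cdots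 x_{\sigma(n)}\big)$ with Koszul signs $\epsilon(\sigma)$ and with $l_2(x,y)=[x,y]$, $l_2(x,h)=l_2(h,x)=[x,h]$, $l_3(x,y,z)=-[x,y,z]$. Let $C=CE(L)\otimes\Omega(M)$ with total differential $d_{tot}=d_{CE(L)}\otimes1+1\otimes d$, where $(1\otimes d)(\eta\otimes\alpha)=(-1)^{|\eta|}\eta\otimes d\alpha$. Put $\omega_k(x_1,\dots,x_k)=\iota_{v_{x_k}}\cdots\iota_{v_{x_1}}\omega$ for $1\le k\le3$, $\widetilde\omega=\omega_1-\omega_2+\omega_3\in C^3$, and $\omega_{3p}(x,y,z)=\omega(v_x,v_y,v_z)|_p$, an element of $CE(L)^3$. Let $r\colon C\to CE(L)$, $r(\eta\otimes\alpha)=\eta\cdot\alpha_p$, where $\alpha_p$ is the value at $p$ if $\alpha$ is a function and $\alpha_p=0$ if $\alpha$ has positive degree. A moment map is regarded as the element $f_1|_{\mathfrak g}+f_1|_{\mathfrak h}+f_2$ of $C^2$. **Statement.** 1. $r$ is a chain map, $r\circ d_{tot}=d_{CE(L)}\circ r$, and $r(\widetilde\omega)=\omega_{3p}$. For every moment map $\phi\in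 C^2$ for $L$ one has $d_{tot}\phi=\widetilde\omega$ and hence $d_{CE(L)}(r(\phi))=\omega_{3p}$. 2. $\omega_{3p}$ is $d_{CE(L)}$-closed. If a moment map for $L$ exists, then $[\omega_{3p}]=0$ in $H^3(CE(L))$. 3. Conversely, if $M$ is connected, $H^1(M)=0$ and $[\omega_{3p}]=0$ in $H^3(CE(L))$, then a moment map for $L$ exists. -/

import Mathlib

open scoped Manifold ContDiff Topology

set_option linter.unusedSectionVars false

noncomputable section

namespace LieTwoMoment

section Forms
variable {E : Type*} [NormedAddCommGroup E] [NormedSpace ℝ E]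
  {M : Type*} [TopologicalSpace M] [ChartedSpace E M]

/-- The expression of a family `θ` of alternating `k`-forms on the tangent spaces of `M` in the
preferred chart `φ` at `x₀`: the pullback `(φ⁻¹)^* θ`, a function from the model space to
alternating forms on the model space. -/
def chartForm {k : ℕ} (θ : ∀ p : M, TangentSpace 𝓘(ℝ, E) p [⋀^Fin k]→L[ℝ] ℝ) (x₀ : M) (y : E) :
    E [⋀^Fin k]→L[ℝ] ℝ :=
  (θ ((extChartAt 𝓘(ℝ, E) x₀).symm y)).compContinuousLinearMap
    (mfderiv 𝓘(ℝ, E) 𝓘(ℝ, E) (extChartAt 𝓘(ℝ, E) x₀).symm y)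

variable (E M) in
/-- The space of families of alternating `k`-forms on the tangent spaces of `M` whose expression in
every preferred chart is smooth. -/
def diffFormSubmodule (k : ℕ) :
    Submodule ℝ (∀ p : M, TangentSpace 𝓘(ℝ, E) p [⋀^Fin k]→L[ℝ] ℝ) where
  carrier := {θ | ∀ x₀ : M, ContDiffOn ℝ ∞ (chartForm θ x₀) (extChartAt 𝓘(ℝ, E) x₀).target}
  add_mem' ha hb x₀ := (ha x₀).add (hb x₀)
  zero_mem' _ := contDiffOn_const (c := (0 : E [⋀^Fin k]→L[ℝ] ℝ))
  smul_mem' c _ ha x₀ := (ha x₀).const_smul c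

variable (E M) in
/-- `Ω^k(M)`: the smooth differential `k`-forms on `M`. -/
def DiffForm (k : ℕ) : Type _ := ↥(diffFormSubmodule E M k)

instance (k : ℕ) : AddCommGroup (DiffForm E M k) :=
  inferInstanceAs (AddCommGroup ↥(diffFormSubmodule E M k))

instance (k : ℕ) : Module ℝ (DiffForm E M k) :=
  inferInstanceAs (Module ℝ ↥(diffFormSubmodule E M k))

theorem chartForm_add {k : ℕ} (a b : ∀ p : M, TangentSpace 𝓘(ℝ, E) p [⋀^Fin k]→L[ℝ] ℝ) (x₀ : M) :
    chartForm (a + b) x₀ = chartForm a x₀ + chartForm b x₀ := rfl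

theorem chartForm_smul {k : ℕ} (c : ℝ) (a : ∀ p : M, TangentSpace 𝓘(ℝ, E) p [⋀^Fin k]→L[ℝ] ℝ)
    (x₀ : M) : chartForm (c • a) x₀ = c • chartForm a x₀ := rfl

/-- The exterior derivative of `θ` at `p`, computed in the preferred chart at `p`. -/
def extDerivPt {k : ℕ} (θ : ∀ p : M, TangentSpace 𝓘(ℝ, E) p [⋀^Fin k]→L[ℝ] ℝ) (p : M) :
    TangentSpace 𝓘(ℝ, E) p [⋀^Fin (k + 1)]→L[ℝ] ℝ :=
  (extDeriv (chartForm θ p) (extChartAt 𝓘(ℝ, E) p p)).compContinuousLinearMap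
    (mfderiv 𝓘(ℝ, E) 𝓘(ℝ, E) (extChartAt 𝓘(ℝ, E) p) p)

/-- `𝔛(M)`: the smooth vector fields on `M`. -/
abbrev VF (E M : Type*) [NormedAddCommGroup E] [NormedSpace ℝ E]
  [TopologicalSpace M] [ChartedSpace E M] [IsManifold 𝓘(ℝ, E) ∞ M] : Type _ :=
  ContMDiffSection 𝓘(ℝ, E) E ∞ (fun p : M => TangentSpace 𝓘(ℝ, E) p)

variable [IsManifold 𝓘(ℝ, E) ∞ M]

theorem chartForm_differentiableAt {k : ℕ} (θ : DiffForm E M k) (x₀ : M) {y : E}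
    (hy : y ∈ (extChartAt 𝓘(ℝ, E) x₀).target) :
    DifferentiableAt ℝ (chartForm θ.1 x₀) y :=
  ((θ.2 x₀).contDiffAt ((isOpen_extChartAt_target x₀).mem_nhds hy)).differentiableAt (by simp)

/-- The exterior derivative is compatible with all charts. -/
theorem chartForm_extDerivPt {k : ℕ} (θ : DiffForm E M k) (x₀ : M) {y : E}
    (hy : y ∈ (extChartAt 𝓘(ℝ, E) x₀).target) :
    chartForm (extDerivPt θ.1) x₀ y = extDeriv (chartForm θ.1 x₀) y := by
  set p : M := (extChartAt 𝓘(ℝ, E) x₀).symm y with hp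
  let f : E → E := fun z => extChartAt 𝓘(ℝ, E) p ((extChartAt 𝓘(ℝ, E) x₀).symm z)
  have hfy : f y = extChartAt 𝓘(ℝ, E) p p := rfl
  have hsymm : ∀ (q : M) {z : E}, z ∈ (extChartAt 𝓘(ℝ, E) q).target →
      MDifferentiableAt 𝓘(ℝ, E) 𝓘(ℝ, E) (extChartAt 𝓘(ℝ, E) q).symm z := by
    intro q z hz
    exact ((contMDiffOn_extChartAt_symm (n := ∞) q).contMDiffAt
      ((isOpen_extChartAt_target q).mem_nhds hz)).mdifferentiableAt (by simp)
  have hchart : ∀ (q : M) {z : M}, z ∈ (extChartAt 𝓘(ℝ, E) q).source →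
      MDifferentiableAt 𝓘(ℝ, E) 𝓘(ℝ, E) (extChartAt 𝓘(ℝ, E) q) z := by
    intro q z hz
    rw [extChartAt_source] at hz
    exact (contMDiffAt_extChartAt' (n := ∞) hz).mdifferentiableAt (by simp)
  have hev : ∀ᶠ z in 𝓝 y, z ∈ (extChartAt 𝓘(ℝ, E) x₀).target ∧
      (extChartAt 𝓘(ℝ, E) x₀).symm z ∈ (extChartAt 𝓘(ℝ, E) p).source := by
    refine ((isOpen_extChartAt_target x₀).mem_nhds hy |> Filter.Eventually.and <| ?_)
    exact (continuousAt_extChartAt_symm'' hy).eventually (extChartAt_source_mem_nhds (I := 𝓘(ℝ, E)) p)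
  have hfd : ∀ {z : E}, z ∈ (extChartAt 𝓘(ℝ, E) x₀).target →
      (extChartAt 𝓘(ℝ, E) x₀).symm z ∈ (extChartAt 𝓘(ℝ, E) p).source →
      fderiv ℝ f z = (mfderiv 𝓘(ℝ, E) 𝓘(ℝ, E) (extChartAt 𝓘(ℝ, E) p)
        ((extChartAt 𝓘(ℝ, E) x₀).symm z)).comp
        (mfderiv 𝓘(ℝ, E) 𝓘(ℝ, E) (extChartAt 𝓘(ℝ, E) x₀).symm z) := by
    intro z hz hz'
    rw [← mfderiv_eq_fderiv]
    exact mfderiv_comp z (hchart p hz') (hsymm x₀ hz)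
  have hfs : ContDiffAt ℝ ∞ f y := by
    have h1 : ContMDiffAt 𝓘(ℝ, E) 𝓘(ℝ, E) ∞ f y :=
      ContMDiffAt.comp y (contMDiffAt_extChartAt (n := ∞))
        ((contMDiffOn_extChartAt_symm (n := ∞) x₀).contMDiffAt
          ((isOpen_extChartAt_target x₀).mem_nhds hy))
    exact h1.contDiffAt
  have key : ∀ (q q' : M) (A : E →L[ℝ] E), q = q' →
      (θ.1 q : E [⋀^Fin k]→L[ℝ] ℝ
        ).compContinuousLinearMap A =
      (θ.1 q' : E [⋀^Fin k]→L[ℝ] ℝ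
        ).compContinuousLinearMap A := by
    rintro q _ A rfl; rfl
  have hloc : chartForm θ.1 x₀ =ᶠ[𝓝 y] fun z =>
      (chartForm θ.1 p (f z)).compContinuousLinearMap (fderiv ℝ f z) := by
    filter_upwards [hev] with z hz
    rw [hfd hz.1 hz.2]
    have hback : (extChartAt 𝓘(ℝ, E) p).symm (f z) = (extChartAt 𝓘(ℝ, E) x₀).symm z :=
      (extChartAt 𝓘(ℝ, E) p).left_inv hz.2
    have hfz : f z ∈ (extChartAt 𝓘(ℝ, E) p).target := (extChartAt 𝓘(ℝ, E) p).map_source hz.2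
    have hcomp : ((mfderiv 𝓘(ℝ, E) 𝓘(ℝ, E) (extChartAt 𝓘(ℝ, E) p).symm (f z) : E →L[ℝ] E).comp
        ((mfderiv 𝓘(ℝ, E) 𝓘(ℝ, E) (extChartAt 𝓘(ℝ, E) p)
        ((extChartAt 𝓘(ℝ, E) x₀).symm z) : E →L[ℝ] E).comp
        (mfderiv 𝓘(ℝ, E) 𝓘(ℝ, E) (extChartAt 𝓘(ℝ, E) x₀).symm z : E →L[ℝ] E))) =
        (mfderiv 𝓘(ℝ, E) 𝓘(ℝ, E) (extChartAt 𝓘(ℝ, E) x₀).symm z : E →L[ℝ] E) := by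
      have hfm : MDifferentiableAt 𝓘(ℝ, E) 𝓘(ℝ, E) f z :=
        MDifferentiableAt.comp z (hchart p hz.2) (hsymm x₀ hz.1)
      have h2 := mfderiv_comp (I' := 𝓘(ℝ, E)) z (hsymm p hfz) hfm
      have h3 : ((extChartAt 𝓘(ℝ, E) p).symm ∘ f) =ᶠ[𝓝 z] (extChartAt 𝓘(ℝ, E) x₀).symm := by
        have : ∀ᶠ w in 𝓝 z, (extChartAt 𝓘(ℝ, E) x₀).symm w ∈ (extChartAt 𝓘(ℝ, E) p).source :=
          (continuousAt_extChartAt_symm'' hz.1).eventually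
            ((isOpen_extChartAt_source p).mem_nhds hz.2)
        filter_upwards [this] with w hw
        exact (extChartAt 𝓘(ℝ, E) p).left_inv hw
      rw [h3.mfderiv_eq] at h2
      rw [mfderiv_eq_fderiv, hfd hz.1 hz.2] at h2
      exact h2.symm
    refine (key _ _ _ hback.symm).trans ?_
    conv_lhs => rw [← hcomp]
    rfl
  rw [hloc.extDeriv_eq, extDeriv_pullback (r := 2)]
  · rw [hfd hy (mem_extChartAt_source p)]
    rfl
  · rw [hfy]
    exact chartForm_differentiableAt θ p (mem_extChartAt_target p)
  · exact hfs.of_le ENat.LEInfty.out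
  · simp

variable (E M) in
/-- The de Rham differential `d_{dR} : Ω^k(M) → Ω^{k+1}(M)`. -/
def extD (k : ℕ) : DiffForm E M k →ₗ[ℝ] DiffForm E M (k + 1) where
  toFun θ := ⟨extDerivPt θ.1, fun x₀ => by
    have h : ContDiffOn ℝ ∞ (extDeriv (chartForm θ.1 x₀))
        (extChartAt 𝓘(ℝ, E) x₀).target := by
      have h1 := ((θ.2 x₀).fderiv_of_isOpen (m := ∞) (isOpen_extChartAt_target x₀) (by simp))
      exact (ContinuousAlternatingMap.alternatizeUncurryFinCLM ℝ E ℝ).contDiff.comp_contDiffOn h1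
    exact h.congr fun y hy => chartForm_extDerivPt θ x₀ hy⟩
  map_add' a b := by
    refine Subtype.ext (funext fun p => ?_)
    show extDerivPt (a.1 + b.1) p = extDerivPt a.1 p + extDerivPt b.1 p
    unfold extDerivPt
    rw [chartForm_add, extDeriv_add (chartForm_differentiableAt a p (mem_extChartAt_target p))
      (chartForm_differentiableAt b p (mem_extChartAt_target p))]
    rfl
  map_smul' c a := by
    refine Subtype.ext (funext fun p => ?_)
    show extDerivPt (c • a.1) p = c • extDerivPt a.1 p
    unfold extDerivPt
    rw [chartForm_smul, extDeriv_smul]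
    rfl

theorem contract_smooth [FiniteDimensional ℝ E] {k : ℕ} (X : VF E M) (θ : DiffForm E M (k + 1)) (x₀ : M) :
    ContDiffOn ℝ ∞ (chartForm (fun p : M =>
      ContinuousAlternatingMap.curryLeft (E := E) (θ.1 p) (X p)) x₀)
      (extChartAt 𝓘(ℝ, E) x₀).target := by
  have : CompleteSpace E := FiniteDimensional.complete ℝ E
  have hX : ContDiffOn ℝ ∞ (VectorField.mpullbackWithin 𝓘(ℝ, E) 𝓘(ℝ, E)
      (extChartAt 𝓘(ℝ, E) x₀).symm (X : ∀ p : M, TangentSpace 𝓘(ℝ, E) p)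
      (extChartAt 𝓘(ℝ, E) x₀).target : E → E) (extChartAt 𝓘(ℝ, E) x₀).target := by
    have h1 := ContMDiffOn.mpullbackWithin_vectorField_inter (I := 𝓘(ℝ, E)) (I' := 𝓘(ℝ, E))
      (m := ∞) (n := ∞) (t := Set.univ)
      (V := (X : ∀ p : M, TangentSpace 𝓘(ℝ, E) p)) X.contMDiff.contMDiffOn
      (contMDiffOn_extChartAt_symm (n := ∞) x₀)
      (fun y hy => by
        have := isInvertible_mfderivWithin_extChartAt_symm (I := 𝓘(ℝ, E)) hy.1
        rw [ModelWithCorners.range_eq_univ, mfderivWithin_univ] at this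
        rwa [mfderivWithin_of_isOpen (isOpen_extChartAt_target x₀) hy.1])
      (isOpen_extChartAt_target x₀).uniqueMDiffOn (by simp)
    rw [Set.preimage_univ, Set.inter_univ] at h1
    exact contMDiffOn_vectorSpace_iff_contDiffOn.1 h1
  have hcurry : ContDiffOn ℝ ∞ (fun y => (chartForm θ.1 x₀ y).curryLeft)
      (extChartAt 𝓘(ℝ, E) x₀).target := by
    have hc : ContDiff ℝ ∞ (fun f : E [⋀^Fin (k + 1)]→L[ℝ] ℝ => f.curryLeft) := by
      refine IsBoundedLinearMap.contDiff ⟨⟨fun _ _ => rfl, fun _ _ => rfl⟩, 1, one_pos, fun f => ?_⟩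
      rw [one_mul, ContinuousAlternatingMap.norm_curryLeft]
    exact hc.comp_contDiffOn (θ.2 x₀)
  have h2 : ContDiffOn ℝ ∞ (fun y => (chartForm θ.1 x₀ y).curryLeft
      ((VectorField.mpullbackWithin 𝓘(ℝ, E) 𝓘(ℝ, E)
      (extChartAt 𝓘(ℝ, E) x₀).symm (X : ∀ p : M, TangentSpace 𝓘(ℝ, E) p)
      (extChartAt 𝓘(ℝ, E) x₀).target : E → E) y)) (extChartAt 𝓘(ℝ, E) x₀).target :=
    hcurry.clm_apply hX
  refine h2.congr fun y hy => ?_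
  have hinv := isInvertible_mfderivWithin_extChartAt_symm (I := 𝓘(ℝ, E)) hy
  rw [ModelWithCorners.range_eq_univ, mfderivWithin_univ] at hinv
  have hval : (mfderiv 𝓘(ℝ, E) 𝓘(ℝ, E) (extChartAt 𝓘(ℝ, E) x₀).symm y : E →L[ℝ] E)
      ((VectorField.mpullbackWithin 𝓘(ℝ, E) 𝓘(ℝ, E)
      (extChartAt 𝓘(ℝ, E) x₀).symm (X : ∀ p : M, TangentSpace 𝓘(ℝ, E) p)
      (extChartAt 𝓘(ℝ, E) x₀).target : E → E) y) = X ((extChartAt 𝓘(ℝ, E) x₀).symm y) := by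
    rw [VectorField.mpullbackWithin_apply,
      mfderivWithin_of_isOpen (isOpen_extChartAt_target x₀) hy]
    exact hinv.self_apply_inverse _
  ext u
  show θ.1 _ (Matrix.vecCons _ _) = θ.1 _ (fun i => _)
  congr 1
  funext i
  refine Fin.cases ?_ (fun i => ?_) i
  · exact hval.symm
  · rfl

/-- The contraction `ι_X θ = θ(X, ·, …, ·)` of a form with a vector field. -/
def contract [FiniteDimensional ℝ E] (X : VF E M) (k : ℕ) : DiffForm E M (k + 1) →ₗ[ℝ] DiffForm E M k where
  toFun θ := ⟨fun p => ContinuousAlternatingMap.curryLeft (E := E) (θ.1 p) (X p),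
    contract_smooth X θ⟩
  map_add' a b := by
    refine Subtype.ext (funext fun p => ?_)
    rfl
  map_smul' c a := by
    refine Subtype.ext (funext fun p => ?_)
    rfl

theorem contract_apply [FiniteDimensional ℝ E] (X : VF E M) (k : ℕ) (θ : DiffForm E M (k + 1))
    (p : M) (u : Fin k → TangentSpace 𝓘(ℝ, E) p) :
    (contract X k θ).1 p u = θ.1 p (Matrix.vecCons (X p) u) := rfl

theorem contract_add_left [FiniteDimensional ℝ E] (X Y : VF E M) (k : ℕ)
    (θ : DiffForm E M (k + 1)) : contract (X + Y) k θ = contract X k θ + contract Y k θ := by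
  refine Subtype.ext (funext fun p => ?_)
  exact (ContinuousAlternatingMap.curryLeft (E := E) (θ.1 p)).map_add (X p) (Y p)

theorem contract_smul_left [FiniteDimensional ℝ E] (c : ℝ) (X : VF E M) (k : ℕ)
    (θ : DiffForm E M (k + 1)) : contract (c • X) k θ = c • contract X k θ := by
  refine Subtype.ext (funext fun p => ?_)
  exact (ContinuousAlternatingMap.curryLeft (E := E) (θ.1 p)).map_smul c (X p)

/-- Evaluation of functions (i.e. `0`-forms) at a point. -/
def evalAt (p : M) : DiffForm E M 0 →ₗ[ℝ] ℝ where
  toFun f := f.1 p ![]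
  map_add' _ _ := rfl
  map_smul' _ _ := rfl

end Forms

section Cohomology
variable {A B C : Type*} [AddCommGroup A] [Module ℝ A] [AddCommGroup B] [Module ℝ B]
  [AddCommGroup C] [Module ℝ C]

/-- The cohomology `ker g / im f` at the middle term of a complex `A → B → C`. -/
abbrev Coh (f : A →ₗ[ℝ] B) (g : B →ₗ[ℝ] C) : Type _ :=
  LinearMap.ker g ⧸ (LinearMap.range f).submoduleOf (LinearMap.ker g)

/-- The class of a cocycle `x`. -/
def Coh.mk (f : A →ₗ[ℝ] B) (g : B →ₗ[ℝ] C) (x : B) (hx : g x = 0) : Coh f g :=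
  Submodule.Quotient.mk ⟨x, hx⟩

end Cohomology

/-- The first de Rham cohomology `H^1(M)`. -/
abbrev DeRhamH1 (E M : Type*) [NormedAddCommGroup E] [NormedSpace ℝ E]
    [TopologicalSpace M] [ChartedSpace E M] [IsManifold 𝓘(ℝ, E) ∞ M] : Type _ :=
  Coh (A := DiffForm E M 0) (B := DiffForm E M 1) (C := DiffForm E M 2)
    (extD E M 0) (extD E M 1)


section CE
variable (𝔤 𝔥 N : Type*) [LieRing 𝔤] [LieAlgebra ℝ 𝔤]
  [AddCommGroup 𝔥] [Module ℝ 𝔥] [LieRingModule 𝔤 𝔥] [LieModule ℝ 𝔤 𝔥]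
  [AddCommGroup N] [Module ℝ N]

/-- The higher Jacobi identity for the ternary bracket `c` of a minimal Lie 2-algebra `𝔥[1] ⊕ 𝔤`:
`c` is a 3-cocycle of `𝔤` with values in the `𝔤`-module `𝔥`. -/
def TripleJacobi {𝔤 𝔥 : Type*} [LieRing 𝔤] [LieAlgebra ℝ 𝔤] [AddCommGroup 𝔥] [Module ℝ 𝔥]
    [LieRingModule 𝔤 𝔥] (c : 𝔤 [⋀^Fin 3]→ₗ[ℝ] 𝔥) : Prop :=
  ∀ x y z u : 𝔤,
    ⁅x, c ![y, z, u]⁆ - ⁅y, c ![x, z, u]⁆ + ⁅z, c ![x, y, u]⁆ - ⁅u, c ![x, y, z]⁆ =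
      c ![⁅x, y⁆, z, u] + c ![y, ⁅x, z⁆, u] + c ![y, z, ⁅x, u⁆]
        - c ![x, ⁅y, z⁆, u] - c ![x, z, ⁅y, u⁆] + c ![x, y, ⁅z, u⁆]

/-- A minimal Lie 2-algebra `𝔥[1] ⊕ 𝔤`: vanishing unary bracket, binary brackets given by the Lie
algebra `𝔤` and the `𝔤`-module `𝔥`, and a ternary bracket `Λ³𝔤 → 𝔥` which satisfies the remaining
higher Jacobi identity. -/
structure MinimalLie2Algebra where
  triple : 𝔤 [⋀^Fin 3]→ₗ[ℝ] 𝔥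
  jacobi : TripleJacobi triple

/-- Symmetric `q`-linear maps on `𝔥` with values in `N`. -/
def SymForm (q : ℕ) : Submodule ℝ (MultilinearMap ℝ (fun _ : Fin q => 𝔥) N) where
  carrier := {f | ∀ (σ : Equiv.Perm (Fin q)) (h : Fin q → 𝔥), f (h ∘ σ) = f h}
  add_mem' ha hb σ h := by simp [ha σ h, hb σ h]
  zero_mem' σ h := rfl
  smul_mem' c a ha σ h := by simp [ha σ h]

variable {𝔤 𝔥 N}

/-- The action of `x ∈ 𝔤` on symmetric forms:
`(x · f)(h₁, …, h_q) = -∑ⱼ f(h₁, …, [x, hⱼ], …, h_q)`. -/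
def SymForm.lieDeriv {q : ℕ} (x : 𝔤) (f : SymForm 𝔥 N q) : SymForm 𝔥 N q :=
  ⟨-∑ j : Fin q, f.1.compLinearMap
      (Function.update (fun _ => LinearMap.id) j (LieModule.toEnd ℝ 𝔤 𝔥 x)), by
    intro σ h
    simp only [neg_apply, sum_apply,
      MultilinearMap.compLinearMap_apply]
    congr 1
    refine Fintype.sum_equiv σ _ _ fun j => ?_
    refine Eq.trans ?_ (f.2 σ _)
    congr 1
    funext i
    simp only [Function.comp_apply]
    by_cases hi : i = j
    · subst hi; simp
    · rw [Function.update_of_ne hi, Function.update_of_ne (σ.injective.ne hi)]⟩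

theorem SymForm.lieDeriv_apply {q : ℕ} (x : 𝔤) (f : SymForm 𝔥 N q) (h : Fin q → 𝔥) :
    (SymForm.lieDeriv x f).1 h = -∑ j : Fin q, f.1 (Function.update h j ⁅x, h j⁆) := by
  simp only [lieDeriv, neg_apply, sum_apply,
      MultilinearMap.compLinearMap_apply]
  congr 1
  refine Finset.sum_congr rfl fun j _ => ?_
  congr 1
  funext i
  by_cases hi : i = j
  · subst hi; simp
  · simp [Function.update_of_ne hi]

/-- `SymForm.lieDeriv` as a bilinear map. -/
def SymForm.act (q : ℕ) : 𝔤 →ₗ[ℝ] SymForm 𝔥 N q →ₗ[ℝ] SymForm 𝔥 N q :=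
  LinearMap.mk₂ ℝ SymForm.lieDeriv
    (fun x y f => by
      refine Subtype.ext (MultilinearMap.ext fun h => ?_)
      simp [SymForm.lieDeriv_apply, Finset.sum_add_distrib, add_comm])
    (fun c x f => by
      refine Subtype.ext (MultilinearMap.ext fun h => ?_)
      simp [SymForm.lieDeriv_apply, Finset.smul_sum])
    (fun x f g => by
      refine Subtype.ext (MultilinearMap.ext fun h => ?_)
      simp [SymForm.lieDeriv_apply, Finset.sum_add_distrib, add_comm])
    (fun c x f => by
      refine Subtype.ext (MultilinearMap.ext fun h => ?_)
      simp [SymForm.lieDeriv_apply, Finset.smul_sum])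

/-- Insertion of `u ∈ 𝔥` into (the first slot of) a symmetric form. -/
def SymForm.insert (q : ℕ) : 𝔥 →ₗ[ℝ] SymForm 𝔥 N (q + 1) →ₗ[ℝ] SymForm 𝔥 N q :=
  LinearMap.mk₂ ℝ (fun u f => ⟨f.1.curryLeft u, fun σ h => by
      have := f.2 (Equiv.Perm.decomposeFin.symm (0, σ)) (Fin.cons u h)
      rw [MultilinearMap.curryLeft_apply, MultilinearMap.curryLeft_apply, ← this]
      congr 1
      funext i
      refine Fin.cases ?_ (fun i => ?_) i <;> simp⟩)
    (fun x y f => Subtype.ext (f.1.curryLeft.map_add x y))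
    (fun c x f => Subtype.ext (f.1.curryLeft.map_smul c x))
    (fun x f g => rfl)
    (fun c x f => rfl)

/-- Elements of `N` as symmetric `0`-forms. -/
def SymForm.const : N →ₗ[ℝ] SymForm 𝔥 N 0 where
  toFun a := ⟨MultilinearMap.constOfIsEmpty ℝ _ a, fun _ _ => rfl⟩
  map_add' _ _ := rfl
  map_smul' _ _ := rfl

/-- Linear maps `𝔥 → N` as symmetric `1`-forms. -/
def SymForm.linear : (𝔥 →ₗ[ℝ] N) →ₗ[ℝ] SymForm 𝔥 N 1 where
  toFun f := ⟨MultilinearMap.ofSubsingleton ℝ 𝔥 N (0 : Fin 1) f, fun σ h => by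
    rw [Subsingleton.elim σ 1]; rfl⟩
  map_add' _ _ := rfl
  map_smul' _ _ := rfl

/-- Composition of the values with a linear map. -/
def SymForm.map {N' : Type*} [AddCommGroup N'] [Module ℝ N'] (φ : N →ₗ[ℝ] N') (q : ℕ) :
    SymForm 𝔥 N q →ₗ[ℝ] SymForm 𝔥 N' q where
  toFun f := ⟨φ.compMultilinearMap f.1, fun σ h => congrArg φ (f.2 σ h)⟩
  map_add' f g := Subtype.ext (by ext; simp)
  map_smul' c f := Subtype.ext (by ext; simp)

variable (𝔤 𝔥 N) in
/-- Chevalley-Eilenberg cochains of bidegree `(p, q)` with values in a vector space `N`: maps which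
are alternating in `p` arguments from `𝔤` (of degree `-1` in `𝔤[1]`) and symmetric in `q` arguments
from `𝔥` (of degree `-2` in `𝔥[2]`). For `N = ℝ` this is the part of
`S^{p+q}(𝔥[2] ⊕ 𝔤[1])^*` of bidegree `(p, q)`, of cohomological degree `p + 2 q`; in general, as `𝔤`
and `𝔥` are finite dimensional, it is the tensor product of that part with `N`. -/
abbrev CEBi (p q : ℕ) : Type _ := 𝔤 [⋀^Fin p]→ₗ[ℝ] SymForm 𝔥 N q

/-- The part of `-d₂` coming from the bracket `𝔤 ⊗ 𝔥 → 𝔥`: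
`ξ ↦ ∑ᵢ (-1)ⁱ (xᵢ · ξ)(x₀, …, x̂ᵢ, …, x_p)`. -/
def ceAct (p q : ℕ) : CEBi 𝔤 𝔥 N p q →ₗ[ℝ] CEBi 𝔤 𝔥 N (p + 1) q where
  toFun ξ := AlternatingMap.alternatizeUncurryFin
    { toFun := fun x => (SymForm.act q x).compAlternatingMap ξ
      map_add' := fun x y => by ext; simp
      map_smul' := fun c x => by ext; simp }
  map_add' ξ η := by
    rw [← AlternatingMap.alternatizeUncurryFin_add]; congr 1; ext; simp
  map_smul' c ξ := by
    rw [RingHom.id_apply, ← AlternatingMap.alternatizeUncurryFin_smul]; congr 1; ext; simp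

/-- Antisymmetrization of a bilinear map `T` with values in `m`-cochains: the signed sum of the
values `T xᵢ xⱼ` on the remaining arguments, over all ordered pairs of distinct indices. -/
def ceAlt2 (m q : ℕ) : (𝔤 →ₗ[ℝ] 𝔤 →ₗ[ℝ] CEBi 𝔤 𝔥 N m q) →ₗ[ℝ] CEBi 𝔤 𝔥 N (m + 2) q :=
  AlternatingMap.alternatizeUncurryFinLM ∘ₗ
    LinearMap.compRight ℝ (M := 𝔤) AlternatingMap.alternatizeUncurryFinLM

/-- Antisymmetrization of a trilinear map `T` with values in `m`-cochains: the signed sum of the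
values `T xᵢ xⱼ x_k` on the remaining arguments, over all ordered triples of distinct indices. -/
def ceAlt3 (m q : ℕ) :
    (𝔤 →ₗ[ℝ] 𝔤 →ₗ[ℝ] 𝔤 →ₗ[ℝ] CEBi 𝔤 𝔥 N m q) →ₗ[ℝ] CEBi 𝔤 𝔥 N (m + 3) q :=
  AlternatingMap.alternatizeUncurryFinLM ∘ₗ LinearMap.compRight ℝ (M := 𝔤) (ceAlt2 m q)

/-- The part of `-d₂` coming from the bracket of `𝔤`:
`ξ ↦ ∑_{i < j} (-1)^{i+j} ξ([xᵢ, xⱼ], x₀, …, x̂ᵢ, …, x̂ⱼ, …, x_p)`, minus the sum over all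
`(2, p-1)`-unshuffles. It is written as a sum over all ordered pairs of arguments, in which every
unshuffle is counted twice, whence the factor `1/2`. -/
def ceBracket (q : ℕ) : ∀ p : ℕ, CEBi 𝔤 𝔥 N p q →ₗ[ℝ] CEBi 𝔤 𝔥 N (p + 1) q
  | 0 => 0
  | p + 1 => (-(1 / 2) : ℝ) • (ceAlt2 p q ∘ₗ
    { toFun := fun ξ => LinearMap.compr₂ (LieAlgebra.ad ℝ 𝔤 : 𝔤 →ₗ[ℝ] 𝔤 →ₗ[ℝ] 𝔤) ξ.curryLeft
      map_add' := fun _ _ => rfl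
      map_smul' := fun _ _ => rfl })

/-- For `u ∈ 𝔥`, the insertion of `u` in the first `𝔥`-slot of a cochain. -/
def ceInsert (m q : ℕ) : 𝔥 →ₗ[ℝ] CEBi 𝔤 𝔥 N m (q + 1) →ₗ[ℝ] CEBi 𝔤 𝔥 N m q :=
  LinearMap.mk₂ ℝ (fun u ξ => (SymForm.insert q u).compAlternatingMap ξ)
    (fun u u' ξ => by ext; simp)
    (fun c u ξ => by ext; simp)
    (fun u ξ η => by ext; simp)
    (fun c u ξ => by ext; simp)

/-- The ternary bracket as a trilinear map. -/
def MinimalLie2Algebra.tripleLin (L : MinimalLie2Algebra 𝔤 𝔥) : 𝔤 →ₗ[ℝ] 𝔤 →ₗ[ℝ] 𝔤 →ₗ[ℝ] 𝔥 :=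
  LinearMap.mk₂ ℝ
    (fun x y =>
      { toFun := fun z => L.triple ![x, y, z]
        map_add' := fun z z' =>
          congrArg (fun f => f ![]) (((L.triple.curryLeft x).curryLeft y).curryLeft.map_add z z')
        map_smul' := fun c z =>
          congrArg (fun f => f ![]) (((L.triple.curryLeft x).curryLeft y).curryLeft.map_smul c z) })
    (fun x x' y => LinearMap.ext fun z =>
      congrArg (fun f => f ![y, z]) (L.triple.curryLeft.map_add x x'))
    (fun c x y => LinearMap.ext fun z =>
      congrArg (fun f => f ![y, z]) (L.triple.curryLeft.map_smul c x))
    (fun x y y' => LinearMap.ext fun z =>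
      congrArg (fun f => f ![z]) ((L.triple.curryLeft x).curryLeft.map_add y y'))
    (fun c x y => LinearMap.ext fun z =>
      congrArg (fun f => f ![z]) ((L.triple.curryLeft x).curryLeft.map_smul c y))

/-- The operator `d₃`, dual to `l₃ = -[·, ·, ·]`: minus the signed sum of
`ξ([xᵢ, xⱼ, x_k], …)` over all `(3, m)`-unshuffles. It is written as a sum over all ordered triples
of arguments, in which every unshuffle is counted six times, whence the factor `1/6`. -/
def ceTriple (L : MinimalLie2Algebra 𝔤 𝔥) (m q : ℕ) :
    CEBi 𝔤 𝔥 N m (q + 1) →ₗ[ℝ] CEBi 𝔤 𝔥 N (m + 3) q :=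
  (-(1 / 6) : ℝ) • (ceAlt3 m q ∘ₗ
    { toFun := fun ξ =>
        { toFun := fun x => (L.tripleLin x).compr₂ ((ceInsert m q).flip ξ)
          map_add' := fun x y => by
            refine LinearMap.ext₂ fun _ _ => ?_
            simp
          map_smul' := fun c x => by
            refine LinearMap.ext₂ fun _ _ => ?_
            simp }
      map_add' := fun ξ η => by
        refine LinearMap.ext fun _ => LinearMap.ext₂ fun _ _ => ?_
        simp
      map_smul' := fun c ξ => by
        refine LinearMap.ext fun _ => LinearMap.ext₂ fun _ _ => ?_
        simp })

variable (𝔤 𝔥 N) in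
/-- Families of cochains of all bidegrees. -/
def CETot : Type _ := ∀ p q : ℕ, CEBi 𝔤 𝔥 N p q

instance : AddCommGroup (CETot 𝔤 𝔥 N) :=
  inferInstanceAs (AddCommGroup (∀ p q : ℕ, CEBi 𝔤 𝔥 N p q))

instance : Module ℝ (CETot 𝔤 𝔥 N) :=
  inferInstanceAs (Module ℝ (∀ p q : ℕ, CEBi 𝔤 𝔥 N p q))

theorem CETot.add_apply (ξ η : CETot 𝔤 𝔥 N) (p q : ℕ) : (ξ + η) p q = ξ p q + η p q := rfl

theorem CETot.smul_apply (c : ℝ) (ξ : CETot 𝔤 𝔥 N) (p q : ℕ) : (c • ξ) p q = c • ξ p q := rfl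

/-- The Chevalley-Eilenberg differential `d_{CE(L)} = -d₂ + d₃` of a minimal Lie 2-algebra, as a
function. -/
def ceTotFun (L : MinimalLie2Algebra 𝔤 𝔥) (ξ : CETot 𝔤 𝔥 N) : CETot 𝔤 𝔥 N := fun p q =>
  match p with
  | 0 => 0
  | 1 => ceAct 0 q (ξ 0 q) + ceBracket q 0 (ξ 0 q)
  | 2 => ceAct 1 q (ξ 1 q) + ceBracket q 1 (ξ 1 q)
  | m + 3 => ceAct (m + 2) q (ξ (m + 2) q) + ceBracket q (m + 2) (ξ (m + 2) q)
      + ceTriple L m q (ξ m (q + 1))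

/-- The Chevalley-Eilenberg differential `d_{CE(L)} = -d₂ + d₃` of a minimal Lie 2-algebra. -/
def ceTotD (L : MinimalLie2Algebra 𝔤 𝔥) : CETot 𝔤 𝔥 N →ₗ[ℝ] CETot 𝔤 𝔥 N where
  toFun := ceTotFun L
  map_add' ξ η := by
    funext p q
    rw [CETot.add_apply]
    match p with
    | 0 => exact (add_zero _).symm
    | 1 => simp only [ceTotFun, CETot.add_apply, map_add]; abel
    | 2 => simp only [ceTotFun, CETot.add_apply, map_add]; abel
    | m + 3 => simp only [ceTotFun, CETot.add_apply, map_add]; abel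
  map_smul' c ξ := by
    funext p q
    rw [RingHom.id_apply, CETot.smul_apply]
    match p with
    | 0 => exact (smul_zero c).symm
    | 1 => simp only [ceTotFun, CETot.smul_apply, map_smul, smul_add]
    | 2 => simp only [ceTotFun, CETot.smul_apply, map_smul, smul_add]
    | m + 3 => simp only [ceTotFun, CETot.smul_apply, map_smul, smul_add]

variable (𝔤 𝔥 N) in
/-- `CE(L)^n` (with values in `N`): the cochains of cohomological degree `n`. The component of
bidegree `(0, 0)` is excluded, as `CE(L)` is built from `S^{≥1}`. -/
def CE (n : ℕ) : Submodule ℝ (CETot 𝔤 𝔥 N) where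
  carrier := {ξ | ∀ p q, p + 2 * q ≠ n ∨ p + 2 * q = 0 → ξ p q = 0}
  add_mem' hξ hη p q h := by rw [CETot.add_apply, hξ p q h, hη p q h, add_zero]
  zero_mem' _ _ _ := rfl
  smul_mem' c ξ hξ p q h := by rw [CETot.smul_apply, hξ p q h, smul_zero]

theorem ceTotD_apply_eq_zero (L : MinimalLie2Algebra 𝔤 𝔥) (ξ : CETot 𝔤 𝔥 N) (p q : ℕ)
    (h₁ : ∀ a, a + 1 = p → ξ a q = 0) (h₂ : ∀ a, a + 3 = p → ξ a (q + 1) = 0) :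
    ceTotD L ξ p q = 0 := by
  show ceTotFun L ξ p q = 0
  match p with
  | 0 => rfl
  | 1 => simp only [ceTotFun, h₁ 0 rfl, map_zero, add_zero]
  | 2 => simp only [ceTotFun, h₁ 1 rfl, map_zero, add_zero]
  | m + 3 => simp only [ceTotFun, h₁ (m + 2) rfl, h₂ m rfl, map_zero, add_zero]

theorem ceTotD_mem (L : MinimalLie2Algebra 𝔤 𝔥) (n : ℕ) (ξ : CETot 𝔤 𝔥 N) (hξ : ξ ∈ CE 𝔤 𝔥 N n) :
    ceTotD L ξ ∈ CE 𝔤 𝔥 N (n + 1) := fun p q _ =>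
  ceTotD_apply_eq_zero L ξ p q (fun a _ => hξ a q (by omega)) (fun a _ => hξ a (q + 1) (by omega))

/-- The Chevalley-Eilenberg complex `CE(L)` of a minimal Lie 2-algebra: the differential
`CE(L)^n → CE(L)^{n+1}`. -/
def ceD (L : MinimalLie2Algebra 𝔤 𝔥) (n : ℕ) : CE 𝔤 𝔥 N n →ₗ[ℝ] CE 𝔤 𝔥 N (n + 1) :=
  (ceTotD L).restrict (ceTotD_mem L n)

/-- The third cohomology `H³(CE(L))`. -/
abbrev CEH3 (L : MinimalLie2Algebra 𝔤 𝔥) : Type _ :=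
  Coh (A := CE 𝔤 𝔥 ℝ 2) (B := CE 𝔤 𝔥 ℝ 3) (C := CE 𝔤 𝔥 ℝ 4) (ceD L 2) (ceD L 3)

/-- The class in `H³(CE(L))` of a cocycle. -/
def CEH3.mk (L : MinimalLie2Algebra 𝔤 𝔥) (x : CE 𝔤 𝔥 ℝ 3) (hx : ceD L 3 x = 0) : CEH3 L :=
  Coh.mk (A := CE 𝔤 𝔥 ℝ 2) (B := CE 𝔤 𝔥 ℝ 3) (C := CE 𝔤 𝔥 ℝ 4) (ceD L 2) (ceD L 3) x hx

/-- The family whose only nonzero component is `ξ`, in bidegree `(p, q)`. -/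
def CETot.single (p q : ℕ) (ξ : CEBi 𝔤 𝔥 N p q) : CETot 𝔤 𝔥 N :=
  Pi.single (M := fun p => ∀ q, CEBi 𝔤 𝔥 N p q) p (Pi.single q ξ)

theorem CETot.single_mem (p q n : ℕ) (hn : p + 2 * q = n) (hn' : n ≠ 0) (ξ : CEBi 𝔤 𝔥 N p q) :
    CETot.single p q ξ ∈ CE 𝔤 𝔥 N n := by
  intro p' q' h
  by_cases hp : p' = p
  · subst hp
    by_cases hq : q' = q
    · omega
    · simp [CETot.single, hq]
  · simp [CETot.single, hp]

variable (𝔥) in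
/-- Alternating maps `Λ^p 𝔤 → N` as cochains of bidegree `(p, 0)`. -/
def ceAlt {p : ℕ} (f : 𝔤 [⋀^Fin p]→ₗ[ℝ] N) : CEBi 𝔤 𝔥 N p 0 := SymForm.const.compAlternatingMap f

variable (𝔤) in
/-- Linear maps `𝔥 → N` as cochains of bidegree `(0, 1)`. -/
def ceLin (f : 𝔥 →ₗ[ℝ] N) : CEBi 𝔤 𝔥 N 0 1 :=
  AlternatingMap.constOfIsEmpty ℝ 𝔤 (Fin 0) (SymForm.linear f)

/-- Composition of the values of cochains with a linear map. -/
def CEBi.map {N' : Type*} [AddCommGroup N'] [Module ℝ N'] (φ : N →ₗ[ℝ] N') (p q : ℕ) :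
    CEBi 𝔤 𝔥 N p q →ₗ[ℝ] CEBi 𝔤 𝔥 N' p q where
  toFun ξ := (SymForm.map φ q).compAlternatingMap ξ
  map_add' ξ η := by ext; simp
  map_smul' c ξ := by ext; simp

end CE

section Total
variable (E M 𝔤 𝔥 : Type*) [NormedAddCommGroup E] [NormedSpace ℝ E]
  [TopologicalSpace M] [ChartedSpace E M]
  [LieRing 𝔤] [LieAlgebra ℝ 𝔤]
  [AddCommGroup 𝔥] [Module ℝ 𝔥] [LieRingModule 𝔤 𝔥] [LieModule ℝ 𝔤 𝔥]

/-- Families of elements of `CE(L) ⊗ Ω^j(M)`, for all `j`. -/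
def TotC : Type _ := ∀ j : ℕ, CETot 𝔤 𝔥 (DiffForm E M j)

instance : AddCommGroup (TotC E M 𝔤 𝔥) :=
  inferInstanceAs (AddCommGroup (∀ j : ℕ, CETot 𝔤 𝔥 (DiffForm E M j)))

instance : Module ℝ (TotC E M 𝔤 𝔥) :=
  inferInstanceAs (Module ℝ (∀ j : ℕ, CETot 𝔤 𝔥 (DiffForm E M j)))

variable {E M 𝔤 𝔥} in
theorem TotC.add_apply (ξ η : TotC E M 𝔤 𝔥) (j : ℕ) : (ξ + η) j = ξ j + η j := rfl

variable {E M 𝔤 𝔥} in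
theorem TotC.smul_apply (c : ℝ) (ξ : TotC E M 𝔤 𝔥) (j : ℕ) : (c • ξ) j = c • ξ j := rfl

/-- The total degree `n` part `C^n = ⨁_{i+j=n} CE(L)^i ⊗ Ω^j(M)` of `C = CE(L) ⊗ Ω(M)`. -/
def CTot (n : ℕ) : Submodule ℝ (TotC E M 𝔤 𝔥) where
  carrier := {ξ | ∀ j p q, p + 2 * q + j ≠ n ∨ p + 2 * q = 0 → ξ j p q = 0}
  add_mem' hξ hη j p q h := by
    rw [TotC.add_apply, CETot.add_apply, hξ j p q h, hη j p q h, add_zero]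
  zero_mem' _ _ _ _ := rfl
  smul_mem' c ξ hξ j p q h := by
    rw [TotC.smul_apply, CETot.smul_apply, hξ j p q h, smul_zero]

variable {E M 𝔤 𝔥}

/-- The total differential `d_tot = d_{CE(L)} ⊗ 1 + 1 ⊗ d_{dR}`, with the Koszul sign
`(1 ⊗ d_{dR}) (η ⊗ α) = (-1)^{|η|} η ⊗ d_{dR} α`, as a function. -/
def totTotFun [IsManifold 𝓘(ℝ, E) ∞ M] (L : MinimalLie2Algebra 𝔤 𝔥) (ξ : TotC E M 𝔤 𝔥) :
    TotC E M 𝔤 𝔥 := fun j p q =>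
  match j with
  | 0 => ceTotD L (ξ 0) p q
  | j + 1 => ceTotD L (ξ (j + 1)) p q
      + (-1 : ℝ) ^ (p + 2 * q) • CEBi.map (extD E M j) p q (ξ j p q)

/-- The total differential `d_tot = d_{CE(L)} ⊗ 1 + 1 ⊗ d_{dR}`. -/
def totTotD [IsManifold 𝓘(ℝ, E) ∞ M] (L : MinimalLie2Algebra 𝔤 𝔥) :
    TotC E M 𝔤 𝔥 →ₗ[ℝ] TotC E M 𝔤 𝔥 where
  toFun := totTotFun L
  map_add' ξ η := by
    funext j p q
    rw [TotC.add_apply, CETot.add_apply]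
    match j with
    | 0 => simp only [totTotFun, TotC.add_apply, CETot.add_apply, map_add]
    | j + 1 => simp only [totTotFun, TotC.add_apply, CETot.add_apply, map_add, smul_add]; abel
  map_smul' c ξ := by
    funext j p q
    rw [RingHom.id_apply, TotC.smul_apply, CETot.smul_apply]
    match j with
    | 0 => simp only [totTotFun, TotC.smul_apply, CETot.smul_apply, map_smul]
    | j + 1 =>
      simp only [totTotFun, TotC.smul_apply, CETot.smul_apply, map_smul, smul_add]
      rw [smul_comm]

theorem totTotD_mem [IsManifold 𝓘(ℝ, E) ∞ M] (L : MinimalLie2Algebra 𝔤 𝔥) (n : ℕ)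
    (ξ : TotC E M 𝔤 𝔥) (hξ : ξ ∈ CTot E M 𝔤 𝔥 n) : totTotD L ξ ∈ CTot E M 𝔤 𝔥 (n + 1) := by
  have key : ∀ j p q, p + 2 * q + j ≠ n + 1 ∨ p + 2 * q = 0 → ceTotD L (ξ j) p q = 0 :=
    fun j p q _ => ceTotD_apply_eq_zero L (ξ j) p q
      (fun a _ => hξ j a q (by omega)) (fun a _ => hξ j a (q + 1) (by omega))
  intro j p q h
  match j with
  | 0 => exact key 0 p q h
  | j + 1 =>
    show ceTotD L (ξ (j + 1)) p q
      + (-1 : ℝ) ^ (p + 2 * q) • CEBi.map (extD E M j) p q (ξ j p q) = 0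
    rw [key (j + 1) p q h, hξ j p q (by omega), map_zero, smul_zero, add_zero]

/-- The total complex `(C, d_tot)`: the differential `C^n → C^{n+1}`. -/
def totD [IsManifold 𝓘(ℝ, E) ∞ M] (L : MinimalLie2Algebra 𝔤 𝔥) (n : ℕ) :
    CTot E M 𝔤 𝔥 n →ₗ[ℝ] CTot E M 𝔤 𝔥 (n + 1) :=
  (totTotD L).restrict (totTotD_mem L n)

/-- The map `r : C^n → CE(L)^n`, `η ⊗ α ↦ η · α_p`, where `α_p` is the value of `α` at `p` if `α` is
a function and `α_p = 0` if `α` is a form of positive degree. -/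
def evalR (p : M) (n : ℕ) : CTot E M 𝔤 𝔥 n →ₗ[ℝ] CE 𝔤 𝔥 ℝ n where
  toFun ξ := ⟨fun a b => CEBi.map (evalAt p) a b (ξ.1 0 a b), fun a b h => by
    show CEBi.map (evalAt p) a b (ξ.1 0 a b) = 0
    rw [ξ.2 0 a b (by simpa using h), map_zero]⟩
  map_add' ξ η := Subtype.ext (by funext a b; exact (CEBi.map (evalAt p) a b).map_add _ _)
  map_smul' c ξ := Subtype.ext (by funext a b; exact (CEBi.map (evalAt p) a b).map_smul c _)

/-- The family whose only nonzero component is `ξ`, in `CE(L)^{p,q} ⊗ Ω^j(M)`. -/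
def TotC.single (j p q : ℕ) (ξ : CEBi 𝔤 𝔥 (DiffForm E M j) p q) : TotC E M 𝔤 𝔥 :=
  Pi.single (M := fun j => CETot 𝔤 𝔥 (DiffForm E M j)) j (CETot.single p q ξ)

theorem TotC.single_mem (j p q n : ℕ) (hn : p + 2 * q + j = n) (hn' : p + 2 * q ≠ 0)
    (ξ : CEBi 𝔤 𝔥 (DiffForm E M j) p q) : TotC.single j p q ξ ∈ CTot E M 𝔤 𝔥 n := by
  intro j' p' q' h
  by_cases hj : j' = j
  · subst hj
    simp only [TotC.single, Pi.single_eq_same]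
    exact CETot.single_mem p q (p + 2 * q) rfl hn' ξ p' q' (by omega)
  · simp only [TotC.single, Pi.single_eq_of_ne hj]
    rfl

end Total

section MomentMaps
variable {E M 𝔤 𝔥 : Type*} [NormedAddCommGroup E] [NormedSpace ℝ E] [FiniteDimensional ℝ E]
  [TopologicalSpace M] [ChartedSpace E M] [IsManifold 𝓘(ℝ, E) ∞ M]
  [LieRing 𝔤] [LieAlgebra ℝ 𝔤]
  [AddCommGroup 𝔥] [Module ℝ 𝔥] [LieRingModule 𝔤 𝔥] [LieModule ℝ 𝔤 𝔥]

/-- A 2-plectic form: a closed 3-form `θ` such that `u ↦ ι_u θ` is injective on `TM`. -/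
def IsTwoPlectic (θ : DiffForm E M 3) : Prop :=
  extD E M 3 θ = 0 ∧
    ∀ p : M, Function.Injective (ContinuousAlternatingMap.curryLeft (E := E) (θ.1 p))

/-- `X` is a Hamiltonian vector field of the 1-form `α`. -/
def IsHamiltonianFor (θ : DiffForm E M 3) (α : DiffForm E M 1) (X : VF E M) : Prop :=
  extD E M 1 α = -contract X 2 θ

/-- `Ω¹_Ham(M)`: the Hamiltonian 1-forms. -/
def HamForm (θ : DiffForm E M 3) : Submodule ℝ (DiffForm E M 1) where
  carrier := {α | ∃ X : VF E M, IsHamiltonianFor θ α X}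
  add_mem' := by
    rintro α β ⟨X, hX⟩ ⟨Y, hY⟩
    refine ⟨X + Y, ?_⟩
    unfold IsHamiltonianFor at *
    rw [map_add, hX, hY, contract_add_left, neg_add]
  zero_mem' := by
    refine ⟨0, ?_⟩
    have h := contract_smul_left (0 : ℝ) (0 : VF E M) 2 θ
    rw [zero_smul, zero_smul] at h
    unfold IsHamiltonianFor
    rw [map_zero, h, neg_zero]
  smul_mem' := by
    rintro c α ⟨X, hX⟩
    refine ⟨c • X, ?_⟩
    unfold IsHamiltonianFor at *
    rw [map_smul, hX, contract_smul_left, smul_neg]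

/-- A Hamiltonian vector field of a Hamiltonian 1-form (unique if `θ` is 2-plectic). -/
def hamVF (θ : DiffForm E M 3) (α : HamForm θ) : VF E M := Classical.choose α.2

/-- The binary bracket of `L_∞(M, θ)` on Hamiltonian 1-forms:
`[α, β]' = i(v_α ∧ v_β) θ = ι_{v_β} ι_{v_α} θ`. -/
def bracket₂ (θ : DiffForm E M 3) (α β : HamForm θ) : DiffForm E M 1 :=
  contract (hamVF θ β) 1 (contract (hamVF θ α) 2 θ)

/-- The ternary bracket of `L_∞(M, θ)` on Hamiltonian 1-forms:
`[α, β, γ]' = -i(v_α ∧ v_β ∧ v_γ) θ`. -/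
def bracket₃ (θ : DiffForm E M 3) (α β γ : HamForm θ) : DiffForm E M 0 :=
  -contract (hamVF θ γ) 0 (contract (hamVF θ β) 1 (contract (hamVF θ α) 2 θ))

/-- A Lie algebra morphism `𝔤 → 𝔛(M)`, `x ↦ v_x`, with values in Hamiltonian vector fields. -/
structure HamiltonianAction (θ : DiffForm E M 3) (𝔤 : Type*) [LieRing 𝔤] [LieAlgebra ℝ 𝔤] where
  v : 𝔤 →ₗ[ℝ] VF E M
  map_lie : ∀ (x y : 𝔤) (p : M), v ⁅x, y⁆ p = VectorField.mlieBracket 𝓘(ℝ, E) (v x) (v y) p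
  hamiltonian : ∀ x : 𝔤, ∃ α : DiffForm E M 1, IsHamiltonianFor θ α (v x)

/-- A homotopy moment map for the minimal Lie 2-algebra `L = 𝔥[1] ⊕ 𝔤`: an `L_∞`-morphism
`(f₁, f₂)` from `L` to `L_∞(M, θ)`, written out in components, with `d f₁(x) = -ι_{v_x} θ`. -/
structure MomentMap (L : MinimalLie2Algebra 𝔤 𝔥) (θ : DiffForm E M 3)
    (act : HamiltonianAction θ 𝔤) where
  f₁ : 𝔤 →ₗ[ℝ] HamForm θ
  f₁h : 𝔥 →ₗ[ℝ] DiffForm E M 0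
  f₂ : 𝔤 [⋀^Fin 2]→ₗ[ℝ] DiffForm E M 0
  moment : ∀ x, IsHamiltonianFor θ (f₁ x : DiffForm E M 1) (act.v x)
  d_f₁h : ∀ h, extD E M 0 (f₁h h) = 0
  d_f₂ : ∀ x y, extD E M 0 (f₂ ![x, y]) =
    (f₁ ⁅x, y⁆ : DiffForm E M 1) - bracket₂ θ (f₁ x) (f₁ y)
  f₁h_lie : ∀ (x : 𝔤) (h : 𝔥), f₁h ⁅x, h⁆ = 0
  f₁h_triple : ∀ x y z, f₁h (L.triple ![x, y, z]) - bracket₃ θ (f₁ x) (f₁ y) (f₁ z) =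
    f₂ ![x, ⁅y, z⁆] - f₂ ![y, ⁅x, z⁆] + f₂ ![z, ⁅x, y⁆]

/-- A moment map as an element of `C²`. -/
def MomentMap.toC {L : MinimalLie2Algebra 𝔤 𝔥} {θ : DiffForm E M 3} {act : HamiltonianAction θ 𝔤}
    (φ : MomentMap L θ act) : CTot E M 𝔤 𝔥 2 :=
  ⟨TotC.single 1 1 0
      (ceAlt 𝔥 (AlternatingMap.ofSubsingleton ℝ 𝔤 (DiffForm E M 1) (0 : Fin 1)
        ((HamForm θ).subtype ∘ₗ φ.f₁)))
    + TotC.single 0 0 1 (ceLin 𝔤 φ.f₁h) + TotC.single 0 2 0 (ceAlt 𝔥 φ.f₂),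
    Submodule.add_mem _ (Submodule.add_mem _
      (TotC.single_mem 1 1 0 2 rfl (by norm_num) _) (TotC.single_mem 0 0 1 2 rfl (by norm_num) _))
      (TotC.single_mem 0 2 0 2 rfl (by norm_num) _)⟩

/-- Evaluation of vector fields at `p`. -/
def evalVF (p : M) : VF E M →ₗ[ℝ] TangentSpace 𝓘(ℝ, E) p where
  toFun X := X p
  map_add' _ _ := rfl
  map_smul' _ _ := rfl

/-- `ω_{3p}(x, y, z) = θ(v_x, v_y, v_z)|_p`, as an alternating map on `𝔤`. -/
def omega3pAlt (θ : DiffForm E M 3) (act : HamiltonianAction θ 𝔤) (p : M) :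
    𝔤 [⋀^Fin 3]→ₗ[ℝ] ℝ :=
  (θ.1 p).toAlternatingMap.compLinearMap (evalVF p ∘ₗ act.v)

variable (𝔥) in
/-- `ω_{3p}`, as an element of `CE(L)³`. -/
def omega3p (θ : DiffForm E M 3) (act : HamiltonianAction θ 𝔤) (p : M) : CE 𝔤 𝔥 ℝ 3 :=
  ⟨CETot.single 3 0 (ceAlt 𝔥 (omega3pAlt θ act p)), CETot.single_mem 3 0 3 rfl (by norm_num) _⟩

theorem contract_contract (X : VF E M) (k : ℕ) (θ : DiffForm E M (k + 2)) :
    contract X k (contract X (k + 1) θ) = 0 := by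
  refine Subtype.ext (funext fun p => ContinuousAlternatingMap.ext fun u => ?_)
  exact (θ.1 p).map_eq_zero_of_eq _ (i := 0) (j := 1) rfl (by simp)

theorem contract_contract_swap (X Y : VF E M) (k : ℕ) (θ : DiffForm E M (k + 2)) :
    contract X k (contract Y (k + 1) θ) = -contract Y k (contract X (k + 1) θ) := by
  have h := contract_contract (X + Y) k θ
  simp only [contract_add_left, map_add, contract_contract, zero_add, add_zero] at h
  exact eq_neg_of_add_eq_zero_right h

/-- `ω_1(x) = ι_{v_x} θ`. -/
def omega₁ (θ : DiffForm E M 3) (act : HamiltonianAction θ 𝔤) :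
    𝔤 [⋀^Fin 1]→ₗ[ℝ] DiffForm E M 2 :=
  AlternatingMap.ofSubsingleton ℝ 𝔤 (DiffForm E M 2) (0 : Fin 1)
    { toFun := fun x => contract (act.v x) 2 θ
      map_add' := fun x y => by rw [map_add, contract_add_left]
      map_smul' := fun c x => by rw [map_smul, contract_smul_left, RingHom.id_apply] }

/-- `ω_2(x, y) = i(v_x ∧ v_y) θ = ι_{v_y} ι_{v_x} θ`. -/
def omega₂ (θ : DiffForm E M 3) (act : HamiltonianAction θ 𝔤) :
    𝔤 [⋀^Fin 2]→ₗ[ℝ] DiffForm E M 1 where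
  toFun x := contract (act.v (x 1)) 1 (contract (act.v (x 0)) 2 θ)
  map_update_add' := by
    intro inst x i a b
    obtain rfl : inst = instDecidableEqFin _ := Subsingleton.elim _ _
    match i with
    | 0 => simp [contract_add_left]
    | 1 => simp [contract_add_left]
  map_update_smul' := by
    intro inst x i c a
    obtain rfl : inst = instDecidableEqFin _ := Subsingleton.elim _ _
    match i with
    | 0 => simp [contract_smul_left]
    | 1 => simp [contract_smul_left]
  map_eq_zero_of_eq' := by
    intro x i j h hij
    have h01 : x 0 = x 1 := by
      fin_cases i <;> fin_cases j <;> simp_all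
    rw [h01, contract_contract]

/-- `ω_3(x, y, z) = i(v_x ∧ v_y ∧ v_z) θ = ι_{v_z} ι_{v_y} ι_{v_x} θ`. -/
def omega₃ (θ : DiffForm E M 3) (act : HamiltonianAction θ 𝔤) :
    𝔤 [⋀^Fin 3]→ₗ[ℝ] DiffForm E M 0 where
  toFun x := contract (act.v (x 2)) 0 (contract (act.v (x 1)) 1 (contract (act.v (x 0)) 2 θ))
  map_update_add' := by
    intro inst x i a b
    obtain rfl : inst = instDecidableEqFin _ := Subsingleton.elim _ _
    match i with
    | 0 => simp [contract_add_left]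
    | 1 => simp [contract_add_left]
    | 2 => simp [contract_add_left]
  map_update_smul' := by
    intro inst x i c a
    obtain rfl : inst = instDecidableEqFin _ := Subsingleton.elim _ _
    match i with
    | 0 => simp [contract_smul_left]
    | 1 => simp [contract_smul_left]
    | 2 => simp [contract_smul_left]
  map_eq_zero_of_eq' := by
    intro x i j h hij
    have h' : x 0 = x 1 ∨ x 1 = x 2 ∨ x 0 = x 2 := by
      fin_cases i <;> fin_cases j <;> simp_all
    rcases h' with h' | h' | h'
    · rw [h', contract_contract, map_zero]
    · rw [h', contract_contract]
    · rw [h', contract_contract_swap, contract_contract, map_zero, neg_zero]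

variable (𝔥) in
/-- `ω̃ = ω_1 - ω_2 + ω_3`, as an element of `C³`. -/
def omegaTilde (θ : DiffForm E M 3) (act : HamiltonianAction θ 𝔤) : CTot E M 𝔤 𝔥 3 :=
  ⟨TotC.single 2 1 0 (ceAlt 𝔥 (omega₁ θ act)) + TotC.single 1 2 0 (ceAlt 𝔥 (-omega₂ θ act))
    + TotC.single 0 3 0 (ceAlt 𝔥 (omega₃ θ act)),
    Submodule.add_mem _ (Submodule.add_mem _
      (TotC.single_mem 2 1 0 3 rfl (by norm_num) _) (TotC.single_mem 1 2 0 3 rfl (by norm_num) _))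
      (TotC.single_mem 0 3 0 3 rfl (by norm_num) _)⟩

end MomentMaps


end LieTwoMoment

end

/-!
Evaluation at `p` commutes with the differentials because the Chevalley-Eilenberg differential is
natural in the coefficients (`CEBi.map_ceTotD`), and the equations which define a moment map are the
components of `d_tot φ = ω̃` (`MomentMap.totD_toC`); so a moment map evaluated at `p` is a primitive of
`ω_{3p}`.

The geometric input is Cartan calculus for the closed form `ω` and the vector fields `v_x`, whose
contractions with `ω` are exact and hence closed. Three identities are needed:
`ι_{[v_x, v_y]} ω = -d ι_{v_y} ι_{v_x} ω` (`contract_isLieBracket`), the formula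
`d ω_3(x, y, z) = -(ω_2(x, [y, z]) - ω_2(y, [x, z]) + ω_2(z, [x, y]))` (`extD_contract₃`) and the cocycle
identity for `ω(v_x, v_y, v_z)` at a point (`isLieBracket_cocycle`). Each is a pointwise statement which,
in the chart at that point, is a linear combination of the equations `dω = 0` and `d ι_{v_x} ω = 0`
written out in terms of the derivatives of `ω` and of the vector fields.

Conversely, let `M` be connected with `H¹(M) = 0`, and let `(b, e)` be a primitive of `ω_{3p}`, where `b`
is an alternating form on `𝔤` and `e` a linear form on `𝔥`. Let `f₁(x)` be a primitive of
`-ι_{v_x} ω`, chosen linearly in `x`, and let `f₁ = e` on `𝔥`. The 1-form `f₁([x, y]) - ω_2(x, y)` is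
closed, hence exact, and `f₂(x, y)` is its primitive with value `b(x, y)` at `p`. The two sides of the
remaining equation have the same differential, by the formula for `d ω_3` and the Jacobi identity, and
the same value at `p`, since `(b, e)` is a primitive of `ω_{3p}`; as `M` is connected, they are equal
(`exists_momentMap`).
-/

noncomputable section

namespace LieTwoMoment

/-! ### The Chevalley-Eilenberg differential -/

section Cochains
variable {𝔤 𝔥 N N' : Type*} [LieRing 𝔤] [LieAlgebra ℝ 𝔤]
  [AddCommGroup 𝔥] [Module ℝ 𝔥] [LieRingModule 𝔤 𝔥] [LieModule ℝ 𝔤 𝔥]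
  [AddCommGroup N] [Module ℝ N] [AddCommGroup N'] [Module ℝ N']

theorem CEBi.ext_apply {p q : ℕ} {ξ η : CEBi 𝔤 𝔥 N p q}
    (h : ∀ x u, (ξ x).1 u = (η x).1 u) : ξ = η :=
  AlternatingMap.ext fun x => Subtype.ext (MultilinearMap.ext fun u => h x u)

theorem CEBi.map_apply (φ : N →ₗ[ℝ] N') (p q : ℕ) (ξ : CEBi 𝔤 𝔥 N p q) (x : Fin p → 𝔤) :
    CEBi.map φ p q ξ x = SymForm.map φ q (ξ x) := rfl

theorem SymForm.map_act (φ : N →ₗ[ℝ] N') (q : ℕ) (x : 𝔤) (f : SymForm 𝔥 N q) :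
    SymForm.map φ q (SymForm.act q x f) = SymForm.act q x (SymForm.map φ q f) := by
  refine Subtype.ext (MultilinearMap.ext fun h => ?_)
  show φ ((SymForm.lieDeriv x f).1 h) = (SymForm.lieDeriv x (SymForm.map φ q f)).1 h
  rw [SymForm.lieDeriv_apply, SymForm.lieDeriv_apply, map_neg, map_sum]
  rfl

/-- The action on the coefficients is trivial, so symmetric forms of degree `0` are invariant. -/
theorem SymForm.act_zero (x : 𝔤) (f : SymForm 𝔥 N 0) : SymForm.act 0 x f = 0 := by
  refine Subtype.ext (MultilinearMap.ext fun h => ?_)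
  show (SymForm.lieDeriv x f).1 h = 0
  rw [SymForm.lieDeriv_apply]
  simp

theorem ceAct_apply (p q : ℕ) (ξ : CEBi 𝔤 𝔥 N p q) (x : Fin (p + 1) → 𝔤) :
    ceAct p q ξ x =
      ∑ i : Fin (p + 1), (-1) ^ (i : ℕ) • SymForm.act q (x i) (ξ (i.removeNth x)) := by
  show AlternatingMap.alternatizeUncurryFin _ x = _
  rw [AlternatingMap.alternatizeUncurryFin_apply]
  rfl

theorem ceAlt2_apply (m q : ℕ) (T : 𝔤 →ₗ[ℝ] 𝔤 →ₗ[ℝ] CEBi 𝔤 𝔥 N m q) (x : Fin (m + 2) → 𝔤) :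
    ceAlt2 m q T x = ∑ i : Fin (m + 2), (-1) ^ (i : ℕ) • ∑ j : Fin (m + 1), (-1) ^ (j : ℕ) •
      T (x i) (i.removeNth x j) (j.removeNth (i.removeNth x)) := by
  show AlternatingMap.alternatizeUncurryFin _ x = _
  rw [AlternatingMap.alternatizeUncurryFin_apply]
  refine Finset.sum_congr rfl fun i _ => ?_
  congr 1
  exact AlternatingMap.alternatizeUncurryFin_apply _ _

theorem ceAlt3_apply (m q : ℕ) (T : 𝔤 →ₗ[ℝ] 𝔤 →ₗ[ℝ] 𝔤 →ₗ[ℝ] CEBi 𝔤 𝔥 N m q)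
    (x : Fin (m + 3) → 𝔤) :
    ceAlt3 m q T x = ∑ i : Fin (m + 3), (-1) ^ (i : ℕ) • ceAlt2 m q (T (x i)) (i.removeNth x) := by
  show AlternatingMap.alternatizeUncurryFin _ x = _
  rw [AlternatingMap.alternatizeUncurryFin_apply]
  rfl

theorem ceBracket_succ_apply (p q : ℕ) (ξ : CEBi 𝔤 𝔥 N (p + 1) q) (x : Fin (p + 2) → 𝔤) :
    ceBracket q (p + 1) ξ x = (-(1 / 2) : ℝ) •
      ∑ i : Fin (p + 2), (-1) ^ (i : ℕ) • ∑ j : Fin (p + 1), (-1) ^ (j : ℕ) •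
        ξ (Matrix.vecCons ⁅x i, i.removeNth x j⁆ (j.removeNth (i.removeNth x))) := by
  show (-(1 / 2) : ℝ) • ceAlt2 p q _ x = _
  rw [ceAlt2_apply]
  rfl

theorem ceTriple_apply (L : MinimalLie2Algebra 𝔤 𝔥) (m q : ℕ) (ξ : CEBi 𝔤 𝔥 N m (q + 1))
    (x : Fin (m + 3) → 𝔤) :
    ceTriple L m q ξ x = (-(1 / 6) : ℝ) •
      ∑ i : Fin (m + 3), (-1) ^ (i : ℕ) • ∑ j : Fin (m + 2), (-1) ^ (j : ℕ) •
        ∑ k : Fin (m + 1), (-1) ^ (k : ℕ) •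
          SymForm.insert q
            (L.triple ![x i, i.removeNth x j, j.removeNth (i.removeNth x) k])
            (ξ (k.removeNth (j.removeNth (i.removeNth x)))) := by
  show (-(1 / 6) : ℝ) • ceAlt3 m q _ x = _
  rw [ceAlt3_apply]
  simp only [ceAlt2_apply]
  rfl

theorem CEBi.map_ceAct (φ : N →ₗ[ℝ] N') (p q : ℕ) (ξ : CEBi 𝔤 𝔥 N p q) :
    CEBi.map φ (p + 1) q (ceAct p q ξ) = ceAct p q (CEBi.map φ p q ξ) := by
  ext1 x
  simp only [CEBi.map_apply, ceAct_apply, map_sum, map_zsmul, SymForm.map_act]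

theorem CEBi.map_ceBracket (φ : N →ₗ[ℝ] N') (p q : ℕ) (ξ : CEBi 𝔤 𝔥 N p q) :
    CEBi.map φ (p + 1) q (ceBracket q p ξ) = ceBracket q p (CEBi.map φ p q ξ) := by
  match p with
  | 0 => exact map_zero _
  | p + 1 =>
    ext1 x
    simp only [CEBi.map_apply, ceBracket_succ_apply, map_sum, map_zsmul, map_smul]

theorem CEBi.map_ceTriple (φ : N →ₗ[ℝ] N') (L : MinimalLie2Algebra 𝔤 𝔥) (m q : ℕ)
    (ξ : CEBi 𝔤 𝔥 N m (q + 1)) :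
    CEBi.map φ (m + 3) q (ceTriple L m q ξ) = ceTriple L m q (CEBi.map φ m (q + 1) ξ) := by
  ext1 x
  simp only [CEBi.map_apply, ceTriple_apply, map_sum, map_zsmul, map_smul]
  rfl

/-- The Chevalley-Eilenberg differential is natural in the coefficients. -/
theorem CEBi.map_ceTotD (φ : N →ₗ[ℝ] N') (L : MinimalLie2Algebra 𝔤 𝔥) (ξ : CETot 𝔤 𝔥 N)
    (p q : ℕ) :
    CEBi.map φ p q (ceTotD L ξ p q) = ceTotD L (fun a b => CEBi.map φ a b (ξ a b)) p q := by
  show CEBi.map φ p q (ceTotFun L ξ p q) = ceTotFun L (fun a b => CEBi.map φ a b (ξ a b)) p q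
  match p with
  | 0 => exact map_zero _
  | 1 => simp only [ceTotFun, map_add, CEBi.map_ceAct, CEBi.map_ceBracket]
  | 2 => simp only [ceTotFun, map_add, CEBi.map_ceAct, CEBi.map_ceBracket]
  | m + 3 =>
    simp only [ceTotFun, map_add, CEBi.map_ceAct, CEBi.map_ceBracket, CEBi.map_ceTriple]

theorem ceAct_right_zero (p : ℕ) (ξ : CEBi 𝔤 𝔥 N p 0) : ceAct p 0 ξ = 0 := by
  ext1 x
  simp [ceAct_apply, SymForm.act_zero]

theorem ceAct_zero_one_apply (ξ : CEBi 𝔤 𝔥 N 0 1) (x : Fin 1 → 𝔤) (u : Fin 1 → 𝔥) :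
    (ceAct 0 1 ξ x).1 u = -(ξ ![]).1 ![⁅x 0, u 0⁆] := by
  rw [ceAct_apply, Fin.sum_univ_one, Fin.val_zero, pow_zero, one_smul]
  refine (SymForm.lieDeriv_apply _ _ _).trans ?_
  rw [Fin.sum_univ_one]
  congr 2
  · congr 2
    exact Subsingleton.elim _ _
  · funext i
    rw [Subsingleton.elim i 0]
    simp

theorem removeNth_zero_vecCons {α : Type*} {n : ℕ} (a : α) (v : Fin n → α) :
    Fin.removeNth 0 (Matrix.vecCons a v) = v := rfl

theorem removeNth_succ_vecCons {α : Type*} {n : ℕ} (a : α) (v : Fin (n + 1) → α)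
    (i : Fin (n + 1)) :
    Fin.removeNth i.succ (Matrix.vecCons a v) = Matrix.vecCons a (i.removeNth v) := by
  funext j
  refine Fin.cases ?_ (fun j => ?_) j <;> simp [Fin.removeNth]

theorem map_vecCons_lie_swap {p : ℕ} (f : 𝔤 [⋀^Fin (p + 1)]→ₗ[ℝ] N) (x y : 𝔤) (v : Fin p → 𝔤) :
    f (Matrix.vecCons ⁅y, x⁆ v) = -f (Matrix.vecCons ⁅x, y⁆ v) := by
  rw [← lie_skew]
  exact congrArg (fun g : 𝔤 [⋀^Fin p]→ₗ[ℝ] N => g v) (map_neg f.curryLeft ⁅x, y⁆)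

/-- Interchanging the first two arguments of an alternating map changes the sign. -/
theorem map_vecCons_swap {V : Type*} [AddCommGroup V] [Module ℝ V] {p : ℕ}
    (f : V [⋀^Fin (p + 2)]→ₗ[ℝ] N) (x y : V) (v : Fin p → V) :
    f (Matrix.vecCons y (Matrix.vecCons x v)) = -f (Matrix.vecCons x (Matrix.vecCons y v)) := by
  rw [← f.map_swap _ (zero_ne_one' (Fin (p + 2)))]
  congr 1
  funext i
  refine Fin.cases (by simp) (fun i => Fin.cases (by simp) (fun i => ?_) i) i
  rw [Function.comp_apply, Equiv.swap_apply_of_ne_of_ne (Fin.succ_ne_zero _) (by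
    rw [← Fin.succ_zero_eq_one, Ne, Fin.succ_inj]; exact Fin.succ_ne_zero _)]
  rfl

/-- Interchanging the second and third arguments of an alternating map changes the sign. -/
theorem map_vecCons_swap_right {V : Type*} [AddCommGroup V] [Module ℝ V] {p : ℕ}
    (f : V [⋀^Fin (p + 3)]→ₗ[ℝ] N) (x y z : V) (v : Fin p → V) :
    f (Matrix.vecCons x (Matrix.vecCons z (Matrix.vecCons y v))) =
      -f (Matrix.vecCons x (Matrix.vecCons y (Matrix.vecCons z v))) :=
  map_vecCons_swap (f.curryLeft x) y z v

theorem ceBracket_one_apply (q : ℕ) (ξ : CEBi 𝔤 𝔥 N 1 q) (x y : 𝔤) :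
    ceBracket q 1 ξ ![x, y] = -ξ ![⁅x, y⁆] := by
  rw [ceBracket_succ_apply]
  simp only [Fin.sum_univ_succ, Fin.sum_univ_zero, removeNth_zero_vecCons, removeNth_succ_vecCons,
    Matrix.cons_val_zero, Matrix.cons_val_succ, Fin.val_succ, Fin.val_zero,
    map_vecCons_lie_swap ξ x y]
  module

theorem ceBracket_two_apply (q : ℕ) (ξ : CEBi 𝔤 𝔥 N 2 q) (x y z : 𝔤) :
    ceBracket q 2 ξ ![x, y, z] = ξ ![x, ⁅y, z⁆] - ξ ![y, ⁅x, z⁆] + ξ ![z, ⁅x, y⁆] := by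
  rw [ceBracket_succ_apply]
  simp only [Fin.sum_univ_succ, Fin.sum_univ_zero, removeNth_zero_vecCons, removeNth_succ_vecCons,
    Matrix.cons_val_zero, Matrix.cons_val_succ, Fin.val_succ, Fin.val_zero,
    map_vecCons_lie_swap ξ x y, map_vecCons_lie_swap ξ x z, map_vecCons_lie_swap ξ y z,
    map_vecCons_swap ξ ⁅y, z⁆ x, map_vecCons_swap ξ ⁅x, z⁆ y, map_vecCons_swap ξ ⁅x, y⁆ z]
  module

theorem ceBracket_three_apply (q : ℕ) (ξ : CEBi 𝔤 𝔥 N 3 q) (x y z w : 𝔤) :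
    ceBracket q 3 ξ ![x, y, z, w] = -ξ ![⁅x, y⁆, z, w] + ξ ![⁅x, z⁆, y, w] - ξ ![⁅x, w⁆, y, z]
      - ξ ![⁅y, z⁆, x, w] + ξ ![⁅y, w⁆, x, z] - ξ ![⁅z, w⁆, x, y] := by
  rw [ceBracket_succ_apply]
  simp only [Fin.sum_univ_succ, Fin.sum_univ_zero, removeNth_zero_vecCons, removeNth_succ_vecCons,
    Matrix.cons_val_zero, Matrix.cons_val_succ, Fin.val_succ, Fin.val_zero,
    map_vecCons_lie_swap ξ x y, map_vecCons_lie_swap ξ x z, map_vecCons_lie_swap ξ y z,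
    map_vecCons_lie_swap ξ x w, map_vecCons_lie_swap ξ y w, map_vecCons_lie_swap ξ z w]
  module

theorem ceTriple_zero_apply (L : MinimalLie2Algebra 𝔤 𝔥) (q : ℕ) (ξ : CEBi 𝔤 𝔥 N 0 (q + 1))
    (x y z : 𝔤) :
    ceTriple L 0 q ξ ![x, y, z] = -SymForm.insert q (L.triple ![x, y, z]) (ξ ![]) := by
  -- all six permutations of the arguments are brought to the order `x, y, z`
  have h1 := map_vecCons_swap_right L.triple x y z ![]
  have h2 := map_vecCons_swap L.triple x y ![z]
  have h3 := map_vecCons_swap_right L.triple y x z ![]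
  have h4 := map_vecCons_swap L.triple x z ![y]
  have h5 := map_vecCons_swap_right L.triple z x y ![]
  rw [h2, neg_neg] at h3
  rw [h1, neg_neg] at h4
  rw [h4] at h5
  rw [ceTriple_apply]
  simp only [Fin.sum_univ_succ, Fin.sum_univ_zero, removeNth_zero_vecCons, removeNth_succ_vecCons,
    Matrix.cons_val_zero, Matrix.cons_val_succ, Fin.val_succ, Fin.val_zero,
    h1, h2, h3, h4, h5, map_neg, LinearMap.neg_apply]
  module

end Cochains

/-! ### Cartan calculus on the model space -/

section ModelSpace
variable {E : Type*} [NormedAddCommGroup E] [NormedSpace ℝ E]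

/-- Contraction of a differential form on the model space with a vector field. -/
def contractFlat {k : ℕ} (X : E → E) (η : E → E [⋀^Fin (k + 1)]→L[ℝ] ℝ) (y : E) :
    E [⋀^Fin k]→L[ℝ] ℝ :=
  (η y).curryLeft (X y)

theorem contractFlat_apply {k : ℕ} (X : E → E) (η : E → E [⋀^Fin (k + 1)]→L[ℝ] ℝ) (y : E)
    (u : Fin k → E) : contractFlat X η y u = η y (Matrix.vecCons (X y) u) := rfl

theorem differentiableAt_and_fderiv_contractFlat {k : ℕ} {X : E → E}
    {η : E → E [⋀^Fin (k + 1)]→L[ℝ] ℝ} {y : E}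
    (hη : DifferentiableAt ℝ η y) (hX : DifferentiableAt ℝ X y) :
    DifferentiableAt ℝ (contractFlat X η) y ∧
    ∀ (a : E) (u : Fin k → E), fderiv ℝ (contractFlat X η) y a u =
      fderiv ℝ η y a (Matrix.vecCons (X y) u) + η y (Matrix.vecCons (fderiv ℝ X y a) u) := by
  have hc : IsBoundedLinearMap ℝ (fun f : E [⋀^Fin (k + 1)]→L[ℝ] ℝ => f.curryLeft) :=
    ⟨⟨fun _ _ => rfl, fun _ _ => rfl⟩, 1, one_pos, fun f => by
      rw [one_mul, ContinuousAlternatingMap.norm_curryLeft]⟩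
  have h1 : HasFDerivAt (fun y => (η y).curryLeft)
      (hc.toContinuousLinearMap.comp (fderiv ℝ η y)) y :=
    HasFDerivAt.comp (g := fun f : E [⋀^Fin (k + 1)]→L[ℝ] ℝ => f.curryLeft) y
      hc.hasFDerivAt hη.hasFDerivAt
  have h2 := h1.clm_apply hX.hasFDerivAt
  refine ⟨h2.differentiableAt, fun a u => ?_⟩
  have h3 : fderiv ℝ (contractFlat X η) y = _ := h2.fderiv
  rw [h3, add_comm]
  rfl

theorem extDeriv_one_apply (η : E → E [⋀^Fin 0]→L[ℝ] ℝ) (y a : E) :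
    extDeriv η y ![a] = fderiv ℝ η y a ![] := by
  rw [extDeriv, ContinuousAlternatingMap.alternatizeUncurryFin_apply]
  simp only [Fin.sum_univ_succ, Fin.sum_univ_zero, removeNth_zero_vecCons,
    Matrix.cons_val_zero, Matrix.cons_val_succ, Fin.val_succ, Fin.val_zero]
  module

theorem extDeriv_two_apply (η : E → E [⋀^Fin 1]→L[ℝ] ℝ) (y a b : E) :
    extDeriv η y ![a, b] = fderiv ℝ η y a ![b] - fderiv ℝ η y b ![a] := by
  rw [extDeriv, ContinuousAlternatingMap.alternatizeUncurryFin_apply]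
  simp only [Fin.sum_univ_succ, Fin.sum_univ_zero, removeNth_zero_vecCons, removeNth_succ_vecCons,
    Matrix.cons_val_zero, Matrix.cons_val_succ, Fin.val_succ, Fin.val_zero]
  module

theorem extDeriv_three_apply (η : E → E [⋀^Fin 2]→L[ℝ] ℝ) (y a b c : E) :
    extDeriv η y ![a, b, c] =
      fderiv ℝ η y a ![b, c] - fderiv ℝ η y b ![a, c] + fderiv ℝ η y c ![a, b] := by
  rw [extDeriv, ContinuousAlternatingMap.alternatizeUncurryFin_apply]
  simp only [Fin.sum_univ_succ, Fin.sum_univ_zero, removeNth_zero_vecCons, removeNth_succ_vecCons,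
    Matrix.cons_val_zero, Matrix.cons_val_succ, Fin.val_succ, Fin.val_zero]
  module

theorem extDeriv_four_apply (η : E → E [⋀^Fin 3]→L[ℝ] ℝ) (y a b c d : E) :
    extDeriv η y ![a, b, c, d] = fderiv ℝ η y a ![b, c, d] - fderiv ℝ η y b ![a, c, d]
      + fderiv ℝ η y c ![a, b, d] - fderiv ℝ η y d ![a, b, c] := by
  rw [extDeriv, ContinuousAlternatingMap.alternatizeUncurryFin_apply]
  simp only [Fin.sum_univ_succ, Fin.sum_univ_zero, removeNth_zero_vecCons, removeNth_succ_vecCons,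
    Matrix.cons_val_zero, Matrix.cons_val_succ, Fin.val_succ, Fin.val_zero]
  module

theorem map_vecCons_sub (f : E [⋀^Fin 3]→L[ℝ] ℝ) (a a' b c : E) :
    f ![a - a', b, c] = f ![a, b, c] - f ![a', b, c] :=
  congrArg (fun g : E [⋀^Fin 2]→L[ℝ] ℝ => g ![b, c]) (map_sub f.curryLeft a a')

theorem map_swap_left (f : E [⋀^Fin 3]→L[ℝ] ℝ) (a b c : E) :
    f ![b, a, c] = -f ![a, b, c] :=
  map_vecCons_swap f.toAlternatingMap a b ![c]

theorem map_swap_right (f : E [⋀^Fin 3]→L[ℝ] ℝ) (a b c : E) :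
    f ![a, c, b] = -f ![a, b, c] :=
  map_vecCons_swap_right f.toAlternatingMap a b c ![]

/-- The exterior derivative of `ι_X η`, in terms of the derivatives of `η` and `X`. -/
theorem extDeriv_contractFlat_apply {X : E → E} {η : E → E [⋀^Fin 3]→L[ℝ] ℝ} {y : E}
    (hη : DifferentiableAt ℝ η y) (hX : DifferentiableAt ℝ X y) (a b c : E) :
    extDeriv (contractFlat X η) y ![a, b, c] =
      (fderiv ℝ η y a ![X y, b, c] + η y ![fderiv ℝ X y a, b, c])
      - (fderiv ℝ η y b ![X y, a, c] + η y ![fderiv ℝ X y b, a, c])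
      + (fderiv ℝ η y c ![X y, a, b] + η y ![fderiv ℝ X y c, a, b]) := by
  rw [extDeriv_three_apply]
  simp only [(differentiableAt_and_fderiv_contractFlat hη hX).2]

/-- For closed `η` and `ι_X η`, `ι_Y η`, Cartan calculus gives
`ι_{[X, Y]} η = L_X ι_Y η = -d ι_Y ι_X η`. -/
theorem contractFlat_lieBracket {η : E → E [⋀^Fin 3]→L[ℝ] ℝ} {y : E}
    (hη : DifferentiableAt ℝ η y) (hd : extDeriv η y = 0) {X Y : E → E}
    (hX : DifferentiableAt ℝ X y) (hY : DifferentiableAt ℝ Y y)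
    (dX : extDeriv (contractFlat X η) y = 0) (dY : extDeriv (contractFlat Y η) y = 0) :
    contractFlat (VectorField.lieBracket ℝ X Y) η y =
      -extDeriv (contractFlat Y (contractFlat X η)) y := by
  ext u
  obtain ⟨a, b, rfl⟩ : ∃ a b, u = ![a, b] := ⟨u 0, u 1, by ext i; fin_cases i <;> rfl⟩
  have h1 : extDeriv η y ![X y, Y y, a, b] = 0 := by rw [hd]; rfl
  have h2 : extDeriv (contractFlat X η) y ![Y y, a, b] = 0 := by rw [dX]; rfl
  have h3 : extDeriv (contractFlat Y η) y ![X y, a, b] = 0 := by rw [dY]; rfl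
  simp only [extDeriv_four_apply, extDeriv_contractFlat_apply hη hX,
    extDeriv_contractFlat_apply hη hY] at h1 h2 h3
  have hXη := differentiableAt_and_fderiv_contractFlat hη hX
  rw [ContinuousAlternatingMap.neg_apply, extDeriv_two_apply, contractFlat_apply]
  simp only [(differentiableAt_and_fderiv_contractFlat hXη.1 hY).2, hXη.2, contractFlat_apply,
    VectorField.lieBracket_eq]
  have s0 := map_vecCons_sub (η y) (fderiv ℝ Y y (X y)) (fderiv ℝ X y (Y y)) a b
  have s1 := map_swap_left (fderiv ℝ η y a) (X y) (Y y) b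
  have s2 := map_swap_left (fderiv ℝ η y b) (X y) (Y y) a
  have s3 := map_swap_left (η y) (X y) (fderiv ℝ Y y b) a
  have s4 := map_swap_left (η y) (X y) (fderiv ℝ Y y a) b
  linarith

/-- The differential of the function `η(X, Y, Z)`, when `η` and its contractions with `X`, `Y`, `Z`
are closed. -/
theorem extDeriv_contractFlat₃ {η : E → E [⋀^Fin 3]→L[ℝ] ℝ} {y : E}
    (hη : DifferentiableAt ℝ η y) (hd : extDeriv η y = 0) {X Y Z : E → E}
    (hX : DifferentiableAt ℝ X y) (hY : DifferentiableAt ℝ Y y) (hZ : DifferentiableAt ℝ Z y)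
    (dX : extDeriv (contractFlat X η) y = 0) (dY : extDeriv (contractFlat Y η) y = 0)
    (dZ : extDeriv (contractFlat Z η) y = 0) :
    extDeriv (contractFlat Z (contractFlat Y (contractFlat X η))) y =
      -(contractFlat (VectorField.lieBracket ℝ Y Z) (contractFlat X η) y
        - contractFlat (VectorField.lieBracket ℝ X Z) (contractFlat Y η) y
        + contractFlat (VectorField.lieBracket ℝ X Y) (contractFlat Z η) y) := by
  ext u
  obtain ⟨a, rfl⟩ : ∃ a, u = ![a] := ⟨u 0, by ext i; fin_cases i; rfl⟩
  have h1 : extDeriv η y ![X y, Y y, Z y, a] = 0 := by rw [hd]; rfl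
  have h2 : extDeriv (contractFlat X η) y ![Y y, Z y, a] = 0 := by rw [dX]; rfl
  have h3 : extDeriv (contractFlat Y η) y ![X y, Z y, a] = 0 := by rw [dY]; rfl
  have h4 : extDeriv (contractFlat Z η) y ![X y, Y y, a] = 0 := by rw [dZ]; rfl
  simp only [extDeriv_four_apply, extDeriv_contractFlat_apply hη hX,
    extDeriv_contractFlat_apply hη hY, extDeriv_contractFlat_apply hη hZ] at h1 h2 h3 h4
  have hXη := differentiableAt_and_fderiv_contractFlat hη hX
  have hYη := differentiableAt_and_fderiv_contractFlat hXη.1 hY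
  rw [extDeriv_one_apply, (differentiableAt_and_fderiv_contractFlat hYη.1 hZ).2]
  simp only [hYη.2, hXη.2, contractFlat_apply, ContinuousAlternatingMap.neg_apply,
    ContinuousAlternatingMap.add_apply, ContinuousAlternatingMap.sub_apply,
    VectorField.lieBracket_eq, map_swap_left (η y) (_ - _), map_vecCons_sub]
  -- all terms are brought to the form `D_v η(·, ·, ·)` or `η(D_v ·, ·, ·)` with ordered arguments
  have s1 := map_swap_left (fderiv ℝ η y (Z y)) (X y) (Y y) a
  have s2 := map_swap_left (fderiv ℝ η y a) (X y) (Y y) (Z y)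
  have s3 := map_swap_left (fderiv ℝ η y (X y)) (Y y) (Z y) a
  have s4 := map_swap_left (fderiv ℝ η y (Y y)) (X y) (Z y) a
  have s5 := map_swap_left (fderiv ℝ η y a) (X y) (Z y) (Y y)
  have s6 := map_swap_right (fderiv ℝ η y a) (X y) (Y y) (Z y)
  have s7 := map_swap_left (η y) (X y) (fderiv ℝ Y y a) (Z y)
  have s8 := map_swap_right (η y) (X y) (fderiv ℝ Z y a) (Y y)
  have s9 := map_swap_left (η y) (X y) (fderiv ℝ Z y a) (Y y)
  linarith

/-- The function `η(X, Y, Z)` of the contracting vector fields satisfies the Chevalley-Eilenberg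
cocycle identity: the derivatives of `η` cancel by `dη = 0`. -/
theorem lieBracket_cocycle {η : E → E [⋀^Fin 3]→L[ℝ] ℝ} {y : E}
    (hη : DifferentiableAt ℝ η y) (hd : extDeriv η y = 0) {X Y Z W : E → E}
    (hX : DifferentiableAt ℝ X y) (hY : DifferentiableAt ℝ Y y) (hZ : DifferentiableAt ℝ Z y)
    (hW : DifferentiableAt ℝ W y)
    (dX : extDeriv (contractFlat X η) y = 0) (dY : extDeriv (contractFlat Y η) y = 0)
    (dZ : extDeriv (contractFlat Z η) y = 0) (dW : extDeriv (contractFlat W η) y = 0) :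
    - η y ![VectorField.lieBracket ℝ X Y y, Z y, W y]
      + η y ![VectorField.lieBracket ℝ X Z y, Y y, W y]
      - η y ![VectorField.lieBracket ℝ X W y, Y y, Z y]
      - η y ![VectorField.lieBracket ℝ Y Z y, X y, W y]
      + η y ![VectorField.lieBracket ℝ Y W y, X y, Z y]
      - η y ![VectorField.lieBracket ℝ Z W y, X y, Y y] = 0 := by
  have h1 : extDeriv η y ![X y, Y y, Z y, W y] = 0 := by rw [hd]; rfl
  have h2 : extDeriv (contractFlat X η) y ![Y y, Z y, W y] = 0 := by rw [dX]; rfl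
  have h3 : extDeriv (contractFlat Y η) y ![X y, Z y, W y] = 0 := by rw [dY]; rfl
  have h4 : extDeriv (contractFlat Z η) y ![X y, Y y, W y] = 0 := by rw [dZ]; rfl
  have h5 : extDeriv (contractFlat W η) y ![X y, Y y, Z y] = 0 := by rw [dW]; rfl
  simp only [extDeriv_four_apply, extDeriv_contractFlat_apply hη hX,
    extDeriv_contractFlat_apply hη hY, extDeriv_contractFlat_apply hη hZ,
    extDeriv_contractFlat_apply hη hW] at h1 h2 h3 h4 h5
  simp only [VectorField.lieBracket_eq, map_vecCons_sub]
  -- the derivatives of `η` are brought to ordered arguments; they add up to a multiple of `dη`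
  have s1 := map_swap_left (fderiv ℝ η y (Z y)) (X y) (Y y) (W y)
  have s2 := map_swap_left (fderiv ℝ η y (W y)) (X y) (Y y) (Z y)
  have s3 := map_swap_left (fderiv ℝ η y (X y)) (Y y) (Z y) (W y)
  have s4 := map_swap_left (fderiv ℝ η y (Y y)) (X y) (Z y) (W y)
  have s5 := map_swap_left (fderiv ℝ η y (W y)) (X y) (Z y) (Y y)
  have s6 := map_swap_right (fderiv ℝ η y (W y)) (X y) (Y y) (Z y)
  have s7 := map_swap_left (fderiv ℝ η y (X y)) (Y y) (W y) (Z y)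
  have s8 := map_swap_right (fderiv ℝ η y (X y)) (Y y) (Z y) (W y)
  have s9 := map_swap_left (fderiv ℝ η y (Y y)) (X y) (W y) (Z y)
  have s10 := map_swap_right (fderiv ℝ η y (Y y)) (X y) (Z y) (W y)
  have s11 := map_swap_left (fderiv ℝ η y (Z y)) (X y) (W y) (Y y)
  have s12 := map_swap_right (fderiv ℝ η y (Z y)) (X y) (Y y) (W y)
  linarith

end ModelSpace

/-! ### Forms and vector fields in charts -/

section ManifoldForms
variable {E : Type*} [NormedAddCommGroup E] [NormedSpace ℝ E]
  {M : Type*} [TopologicalSpace M] [ChartedSpace E M]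

/-- The expression of a vector field on `M` in the preferred chart `φ` at `x₀`, i.e. its pullback under
`φ⁻¹`; it is meaningful on the target of `φ`, where the derivative of `φ⁻¹` is invertible. -/
def chartVF (X : ∀ p : M, TangentSpace 𝓘(ℝ, E) p) (x₀ : M) (y : E) : E :=
  (mfderiv 𝓘(ℝ, E) 𝓘(ℝ, E) (extChartAt 𝓘(ℝ, E) x₀).symm y).inverse
    (X ((extChartAt 𝓘(ℝ, E) x₀).symm y))

variable [IsManifold 𝓘(ℝ, E) ∞ M]

theorem isInvertible_mfderiv_extChartAt_symm (x₀ : M) {y : E}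
    (hy : y ∈ (extChartAt 𝓘(ℝ, E) x₀).target) :
    (mfderiv 𝓘(ℝ, E) 𝓘(ℝ, E) (extChartAt 𝓘(ℝ, E) x₀).symm y).IsInvertible := by
  have : IsManifold 𝓘(ℝ, E) 1 M := .of_le (n := ∞) (by simp)
  have h := isInvertible_mfderivWithin_extChartAt_symm (I := 𝓘(ℝ, E)) hy
  rwa [ModelWithCorners.range_eq_univ, mfderivWithin_univ] at h

theorem mfderiv_symm_chartVF (X : ∀ p : M, TangentSpace 𝓘(ℝ, E) p) (x₀ : M) {y : E}
    (hy : y ∈ (extChartAt 𝓘(ℝ, E) x₀).target) :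
    (mfderiv 𝓘(ℝ, E) 𝓘(ℝ, E) (extChartAt 𝓘(ℝ, E) x₀).symm y : E →L[ℝ] E)
        (chartVF (E := E) X x₀ y) =
      X ((extChartAt 𝓘(ℝ, E) x₀).symm y) := by
  have h := isInvertible_mfderiv_extChartAt_symm x₀ hy
  exact h.self_apply_inverse _

theorem chartVF_differentiableAt [FiniteDimensional ℝ E] (X : VF E M) (x₀ : M) {y : E}
    (hy : y ∈ (extChartAt 𝓘(ℝ, E) x₀).target) : DifferentiableAt ℝ (chartVF X x₀) y := by
  have : CompleteSpace E := FiniteDimensional.complete ℝ E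
  have h1 := ContMDiffOn.mpullbackWithin_vectorField_inter (I := 𝓘(ℝ, E)) (I' := 𝓘(ℝ, E))
    (m := ∞) (n := ∞) (t := Set.univ)
    (V := (X : ∀ p : M, TangentSpace 𝓘(ℝ, E) p)) X.contMDiff.contMDiffOn
    (contMDiffOn_extChartAt_symm (n := ∞) x₀)
    (fun y hy => by
      rw [mfderivWithin_of_isOpen (isOpen_extChartAt_target x₀) hy.1]
      exact isInvertible_mfderiv_extChartAt_symm x₀ hy.1)
    (isOpen_extChartAt_target x₀).uniqueMDiffOn (by simp)
  rw [Set.preimage_univ, Set.inter_univ] at h1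
  have h2 : ContDiffOn ℝ ∞ (VectorField.mpullbackWithin 𝓘(ℝ, E) 𝓘(ℝ, E)
      (extChartAt 𝓘(ℝ, E) x₀).symm (X : ∀ p : M, TangentSpace 𝓘(ℝ, E) p)
      (extChartAt 𝓘(ℝ, E) x₀).target : E → E) (extChartAt 𝓘(ℝ, E) x₀).target :=
    contMDiffOn_vectorSpace_iff_contDiffOn.1 h1
  have h3 : ContDiffOn ℝ ∞ (chartVF X x₀) (extChartAt 𝓘(ℝ, E) x₀).target := by
    refine h2.congr fun z hz => ?_
    rw [VectorField.mpullbackWithin_apply,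
      mfderivWithin_of_isOpen (isOpen_extChartAt_target x₀) hz]
    rfl
  exact (h3.contDiffAt ((isOpen_extChartAt_target x₀).mem_nhds hy)).differentiableAt (by simp)

theorem chartForm_contract [FiniteDimensional ℝ E] (X : VF E M) (k : ℕ) (θ : DiffForm E M (k + 1))
    (x₀ : M) {y : E} (hy : y ∈ (extChartAt 𝓘(ℝ, E) x₀).target) :
    chartForm (contract X k θ).1 x₀ y = contractFlat (chartVF X x₀) (chartForm θ.1 x₀) y := by
  ext u
  show θ.1 _ (Matrix.vecCons _ _) = θ.1 _ (fun i => _)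
  congr 1
  funext i
  refine Fin.cases ?_ (fun i => ?_) i
  · exact (mfderiv_symm_chartVF X x₀ hy).symm
  · rfl

theorem chartForm_contract_eventuallyEq [FiniteDimensional ℝ E] (X : VF E M) (k : ℕ)
    (θ : DiffForm E M (k + 1)) (p : M) :
    chartForm (contract X k θ).1 p =ᶠ[𝓝 (extChartAt 𝓘(ℝ, E) p p)]
      contractFlat (chartVF X p) (chartForm θ.1 p) :=
  Filter.eventually_of_mem (extChartAt_target_mem_nhds p) fun _ hy => chartForm_contract X k θ p hy

theorem contractFlat_eventuallyEq {k : ℕ} {X : E → E} {η η' : E → E [⋀^Fin (k + 1)]→L[ℝ] ℝ} {y : E}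
    (h : η =ᶠ[𝓝 y] η') : contractFlat X η =ᶠ[𝓝 y] contractFlat X η' := by
  filter_upwards [h] with z hz
  rw [contractFlat, contractFlat, hz]

theorem chartForm_extD (k : ℕ) (θ : DiffForm E M k) (x₀ : M) {y : E}
    (hy : y ∈ (extChartAt 𝓘(ℝ, E) x₀).target) :
    chartForm (extD E M k θ).1 x₀ y = extDeriv (chartForm θ.1 x₀) y :=
  chartForm_extDerivPt θ x₀ hy

theorem extDeriv_chartForm_eq_zero {k : ℕ} {θ : DiffForm E M k} (h : extD E M k θ = 0) (x₀ : M)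
    {y : E} (hy : y ∈ (extChartAt 𝓘(ℝ, E) x₀).target) : extDeriv (chartForm θ.1 x₀) y = 0 := by
  rw [← chartForm_extD k θ x₀ hy, h]
  rfl

theorem mfderiv_extChartAt_symm_self (p : M) :
    (mfderiv 𝓘(ℝ, E) 𝓘(ℝ, E) (extChartAt 𝓘(ℝ, E) p).symm (extChartAt 𝓘(ℝ, E) p p) : E →L[ℝ] E) =
      ContinuousLinearMap.id ℝ E := by
  have : IsManifold 𝓘(ℝ, E) 1 M := .of_le (n := ∞) (by simp)
  have h := mfderivWithin_range_extChartAt_symm (I := 𝓘(ℝ, E)) (x := p)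
  rw [ModelWithCorners.range_eq_univ, mfderivWithin_univ] at h
  exact h

/-- The chart at `p` identifies the tangent space at `p` with the model space by the identity. -/
theorem chartForm_self_apply {k : ℕ} (θ : ∀ p : M, TangentSpace 𝓘(ℝ, E) p [⋀^Fin k]→L[ℝ] ℝ) (p : M)
    (u : Fin k → E) : chartForm θ p (extChartAt 𝓘(ℝ, E) p p) u = θ p u := by
  -- `φ⁻¹ (φ p) = p` is not definitional, so the base point has to be transported
  have e : ∀ q : M, q = p → (θ q : E [⋀^Fin k]→L[ℝ] ℝ) u = (θ p : E [⋀^Fin k]→L[ℝ] ℝ) u := by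
    intro q hq
    rw [hq]
  refine Eq.trans ?_ (e _ (extChartAt_to_inv (I := 𝓘(ℝ, E)) p))
  exact congrArg (θ ((extChartAt 𝓘(ℝ, E) p).symm (extChartAt 𝓘(ℝ, E) p p)) : (Fin k → E) → ℝ)
    (funext fun i => congrArg (fun A : E →L[ℝ] E => A (u i)) (mfderiv_extChartAt_symm_self p))

/-- Two forms are equal if at every point `p` their expressions in the chart at `p` agree. -/
theorem DiffForm.ext_chartForm {k : ℕ} {α β : DiffForm E M k}
    (h : ∀ p : M, chartForm α.1 p (extChartAt 𝓘(ℝ, E) p p) =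
      chartForm β.1 p (extChartAt 𝓘(ℝ, E) p p)) : α = β := by
  refine Subtype.ext (funext fun p => ContinuousAlternatingMap.ext fun u => ?_)
  exact (chartForm_self_apply α.1 p u).symm.trans
    ((congrArg (fun f : E [⋀^Fin k]→L[ℝ] ℝ => f u) (h p)).trans (chartForm_self_apply β.1 p u))

theorem extD_extD (k : ℕ) (θ : DiffForm E M k) : extD E M (k + 1) (extD E M k θ) = 0 := by
  refine DiffForm.ext_chartForm fun p => ?_
  have hp := mem_extChartAt_target (I := 𝓘(ℝ, E)) p
  rw [chartForm_extD _ _ p hp]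
  have h1 : chartForm (extD E M k θ).1 p =ᶠ[𝓝 (extChartAt 𝓘(ℝ, E) p p)]
      extDeriv (chartForm θ.1 p) :=
    Filter.eventually_of_mem (extChartAt_target_mem_nhds p) fun _ hy => chartForm_extD k θ p hy
  rw [h1.extDeriv_eq]
  exact extDeriv_extDeriv_apply ((θ.2 p).contDiffAt (extChartAt_target_mem_nhds p))
    (by simpa using ENat.LEInfty.out)

theorem chartVF_self (X : ∀ p : M, TangentSpace 𝓘(ℝ, E) p) (p : M) :
    chartVF X p (extChartAt 𝓘(ℝ, E) p p) = X p := by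
  -- the base point is transported along `φ⁻¹ (φ p) = p`
  have e : ∀ q : M, q = p → (X q : E) = (X p : E) := by
    intro q hq
    rw [hq]
  refine Eq.trans ?_ (e _ (extChartAt_to_inv (I := 𝓘(ℝ, E)) p))
  refine (congrArg (fun A : E →L[ℝ] E => A.inverse
    (X ((extChartAt 𝓘(ℝ, E) p).symm (extChartAt 𝓘(ℝ, E) p p)) : E))
      (mfderiv_extChartAt_symm_self p)).trans ?_
  simp only [ContinuousLinearMap.inverse_id]
  rfl

theorem mlieBracket_eq_lieBracket_chartVF (X Y : ∀ p : M, TangentSpace 𝓘(ℝ, E) p) (p : M) :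
    VectorField.mlieBracket 𝓘(ℝ, E) X Y p =
      VectorField.lieBracket ℝ (chartVF X p) (chartVF Y p) (extChartAt 𝓘(ℝ, E) p p) := by
  have : IsManifold 𝓘(ℝ, E) 1 M := .of_le (n := ∞) (by simp)
  have e : ∀ V : ∀ p : M, TangentSpace 𝓘(ℝ, E) p,
      VectorField.mpullbackWithin 𝓘(ℝ, E) 𝓘(ℝ, E) (extChartAt 𝓘(ℝ, E) p).symm V Set.univ =
        chartVF V p := by
    intro V
    funext y
    rw [VectorField.mpullbackWithin_apply, mfderivWithin_univ]
    rfl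
  rw [VectorField.mlieBracket, VectorField.mlieBracketWithin]
  simp only [ModelWithCorners.range_eq_univ, Set.preimage_univ, Set.inter_univ,
    VectorField.lieBracketWithin_univ, e]
  have h : (mfderiv 𝓘(ℝ, E) 𝓘(ℝ, E) (extChartAt 𝓘(ℝ, E) p) p : E →L[ℝ] E) =
      ContinuousLinearMap.id ℝ E := mfderiv_extChartAt_self
  refine (congrArg (fun A : E →L[ℝ] E => A.inverse (VectorField.lieBracket ℝ (chartVF X p)
    (chartVF Y p) (extChartAt 𝓘(ℝ, E) p p))) h).trans ?_
  simp only [ContinuousLinearMap.inverse_id]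
  rfl

end ManifoldForms

/-! ### Cartan calculus on the manifold -/

section CartanCalculus
variable {E : Type*} [NormedAddCommGroup E] [NormedSpace ℝ E] [FiniteDimensional ℝ E]
  {M : Type*} [TopologicalSpace M] [ChartedSpace E M] [IsManifold 𝓘(ℝ, E) ∞ M]

theorem chartForm_coe_sub {k : ℕ} (α β : DiffForm E M k) (x₀ : M) :
    chartForm (α - β).1 x₀ = chartForm α.1 x₀ - chartForm β.1 x₀ := rfl

theorem chartForm_coe_add {k : ℕ} (α β : DiffForm E M k) (x₀ : M) :
    chartForm (α + β).1 x₀ = chartForm α.1 x₀ + chartForm β.1 x₀ := rfl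

theorem chartForm_coe_neg {k : ℕ} (α : DiffForm E M k) (x₀ : M) :
    chartForm (-α).1 x₀ = -chartForm α.1 x₀ := rfl

theorem extDeriv_contractFlat_chartVF_eq_zero {k : ℕ} {θ : DiffForm E M (k + 1)} {X : VF E M}
    (h : extD E M k (contract X k θ) = 0) (p : M) :
    extDeriv (contractFlat (chartVF X p) (chartForm θ.1 p)) (extChartAt 𝓘(ℝ, E) p p) = 0 := by
  rw [← (chartForm_contract_eventuallyEq X k θ p).extDeriv_eq]
  exact extDeriv_chartForm_eq_zero h p (mem_extChartAt_target p)

theorem chartForm_contract₂_eventuallyEq {k : ℕ} (X : VF E M)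
    (θ : DiffForm E M (k + 2)) (Y : VF E M) (p : M) :
    chartForm (contract X k (contract Y (k + 1) θ)).1 p =ᶠ[𝓝 (extChartAt 𝓘(ℝ, E) p p)]
      contractFlat (chartVF X p) (contractFlat (chartVF Y p) (chartForm θ.1 p)) :=
  (chartForm_contract_eventuallyEq X k _ p).trans
    (contractFlat_eventuallyEq (chartForm_contract_eventuallyEq Y (k + 1) θ p))

theorem contractFlat_congr {k : ℕ} {X X' : E → E} {η : E → E [⋀^Fin (k + 1)]→L[ℝ] ℝ} {y : E}
    (h : X y = X' y) : contractFlat X η y = contractFlat X' η y := by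
  rw [contractFlat, contractFlat, h]

/-- The vector field `Z` is the Lie bracket `[X, Y]`. The bracket of vector fields enters as a
relation, as the bracket of two smooth sections is not bundled as a smooth section. -/
def IsLieBracket (Z X Y : VF E M) : Prop :=
  ∀ p, Z p = VectorField.mlieBracket 𝓘(ℝ, E) X Y p

theorem IsLieBracket.chartVF_eq {X Y Z : VF E M} (h : IsLieBracket Z X Y) (p : M) :
    chartVF Z p (extChartAt 𝓘(ℝ, E) p p) =
      VectorField.lieBracket ℝ (chartVF X p) (chartVF Y p) (extChartAt 𝓘(ℝ, E) p p) := by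
  rw [chartVF_self, ← mlieBracket_eq_lieBracket_chartVF]
  exact h p

variable {θ : DiffForm E M 3}

/-- `ι_{[X, Y]} θ = -d ι_Y ι_X θ` for closed `θ`, `ι_X θ` and `ι_Y θ`. -/
theorem contract_isLieBracket (hθ : extD E M 3 θ = 0) {X Y XY : VF E M} (hXY : IsLieBracket XY X Y)
    (hX : extD E M 2 (contract X 2 θ) = 0) (hY : extD E M 2 (contract Y 2 θ) = 0) :
    contract XY 2 θ = -extD E M 1 (contract Y 1 (contract X 2 θ)) := by
  refine DiffForm.ext_chartForm fun p => ?_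
  have hp := mem_extChartAt_target (I := 𝓘(ℝ, E)) p
  rw [chartForm_contract _ _ _ p hp, chartForm_coe_neg, Pi.neg_apply, chartForm_extD _ _ p hp,
    (chartForm_contract₂_eventuallyEq Y θ X p).extDeriv_eq,
    contractFlat_congr (hXY.chartVF_eq p)]
  exact contractFlat_lieBracket (chartForm_differentiableAt θ p hp)
    (extDeriv_chartForm_eq_zero hθ p hp) (chartVF_differentiableAt X p hp)
    (chartVF_differentiableAt Y p hp) (extDeriv_contractFlat_chartVF_eq_zero hX p)
    (extDeriv_contractFlat_chartVF_eq_zero hY p)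

/-- The differential of the function `θ(X, Y, Z)`, when `θ` and its contractions with `X`, `Y`, `Z` are
closed. -/
theorem extD_contract₃ (hθ : extD E M 3 θ = 0) {X Y Z XY XZ YZ : VF E M} (hXY : IsLieBracket XY X Y)
    (hXZ : IsLieBracket XZ X Z) (hYZ : IsLieBracket YZ Y Z)
    (hX : extD E M 2 (contract X 2 θ) = 0) (hY : extD E M 2 (contract Y 2 θ) = 0)
    (hZ : extD E M 2 (contract Z 2 θ) = 0) :
    extD E M 0 (contract Z 0 (contract Y 1 (contract X 2 θ))) =
      -(contract YZ 1 (contract X 2 θ) - contract XZ 1 (contract Y 2 θ)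
        + contract XY 1 (contract Z 2 θ)) := by
  refine DiffForm.ext_chartForm fun p => ?_
  have hp := mem_extChartAt_target (I := 𝓘(ℝ, E)) p
  have h3 : chartForm (contract Z 0 (contract Y 1 (contract X 2 θ))).1 p
      =ᶠ[𝓝 (extChartAt 𝓘(ℝ, E) p p)] contractFlat (chartVF Z p)
        (contractFlat (chartVF Y p) (contractFlat (chartVF X p) (chartForm θ.1 p))) :=
    (chartForm_contract_eventuallyEq Z 0 _ p).trans
      (contractFlat_eventuallyEq (chartForm_contract₂_eventuallyEq Y θ X p))
  rw [chartForm_extD _ _ p hp, h3.extDeriv_eq, chartForm_coe_neg, chartForm_coe_add,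
    chartForm_coe_sub,
    Pi.neg_apply, Pi.add_apply, Pi.sub_apply,
    (chartForm_contract₂_eventuallyEq YZ θ X p).eq_of_nhds,
    (chartForm_contract₂_eventuallyEq XZ θ Y p).eq_of_nhds,
    (chartForm_contract₂_eventuallyEq XY θ Z p).eq_of_nhds,
    contractFlat_congr (hXY.chartVF_eq p), contractFlat_congr (hXZ.chartVF_eq p),
    contractFlat_congr (hYZ.chartVF_eq p)]
  exact extDeriv_contractFlat₃ (chartForm_differentiableAt θ p hp)
    (extDeriv_chartForm_eq_zero hθ p hp) (chartVF_differentiableAt X p hp)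
    (chartVF_differentiableAt Y p hp) (chartVF_differentiableAt Z p hp)
    (extDeriv_contractFlat_chartVF_eq_zero hX p)
    (extDeriv_contractFlat_chartVF_eq_zero hY p) (extDeriv_contractFlat_chartVF_eq_zero hZ p)

/-- The values `θ(X, Y, Z)` on vector fields which contract the closed form `θ` to closed forms satisfy
the Chevalley-Eilenberg cocycle identity. -/
theorem isLieBracket_cocycle (hθ : extD E M 3 θ = 0) {X Y Z W XY XZ XW YZ YW ZW : VF E M}
    (hXY : IsLieBracket XY X Y)
    (hXZ : IsLieBracket XZ X Z) (hXW : IsLieBracket XW X W) (hYZ : IsLieBracket YZ Y Z)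
    (hYW : IsLieBracket YW Y W) (hZW : IsLieBracket ZW Z W)
    (hX : extD E M 2 (contract X 2 θ) = 0) (hY : extD E M 2 (contract Y 2 θ) = 0)
    (hZ : extD E M 2 (contract Z 2 θ) = 0) (hW : extD E M 2 (contract W 2 θ) = 0) (p : M) :
    -θ.1 p ![XY p, Z p, W p] + θ.1 p ![XZ p, Y p, W p] - θ.1 p ![XW p, Y p, Z p]
      - θ.1 p ![YZ p, X p, W p] + θ.1 p ![YW p, X p, Z p] - θ.1 p ![ZW p, X p, Y p] = 0 := by
  have hp := mem_extChartAt_target (I := 𝓘(ℝ, E)) p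
  have h := lieBracket_cocycle (chartForm_differentiableAt θ p hp)
    (extDeriv_chartForm_eq_zero hθ p hp) (chartVF_differentiableAt X p hp)
    (chartVF_differentiableAt Y p hp) (chartVF_differentiableAt Z p hp)
    (chartVF_differentiableAt W p hp)
    (extDeriv_contractFlat_chartVF_eq_zero hX p) (extDeriv_contractFlat_chartVF_eq_zero hY p)
    (extDeriv_contractFlat_chartVF_eq_zero hZ p) (extDeriv_contractFlat_chartVF_eq_zero hW p)
  rw [← hXY.chartVF_eq, ← hXZ.chartVF_eq, ← hXW.chartVF_eq, ← hYZ.chartVF_eq, ← hYW.chartVF_eq,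
    ← hZW.chartVF_eq] at h
  simp only [chartVF_self, chartForm_self_apply] at h
  exact h

end CartanCalculus

/-! ### Functions -/

section Functions
variable {E : Type*} [NormedAddCommGroup E] [NormedSpace ℝ E]
  {M : Type*} [TopologicalSpace M] [ChartedSpace E M]

theorem DiffForm.ext_evalAt {f g : DiffForm E M 0} (h : ∀ p : M, evalAt p f = evalAt p g) :
    f = g := by
  refine Subtype.ext (funext fun p => ContinuousAlternatingMap.ext fun u => ?_)
  rw [Subsingleton.elim u ![]]
  exact h p

variable (E M) in
/-- The constant functions on `M`. -/
def constFun : ℝ →ₗ[ℝ] DiffForm E M 0 where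
  toFun c := ⟨fun _ => ContinuousAlternatingMap.constOfIsEmpty ℝ E (Fin 0) c, fun _ =>
    contDiffOn_const (c := ContinuousAlternatingMap.constOfIsEmpty ℝ E (Fin 0) c)⟩
  map_add' _ _ := rfl
  map_smul' _ _ := rfl

theorem evalAt_constFun (p : M) (c : ℝ) : evalAt p (constFun E M c) = c := rfl

variable [IsManifold 𝓘(ℝ, E) ∞ M]

theorem extD_constFun (c : ℝ) : extD E M 0 (constFun E M c) = 0 := by
  refine DiffForm.ext_chartForm fun p => ?_
  rw [chartForm_extD _ _ p (mem_extChartAt_target p)]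
  show extDeriv (fun _ => ContinuousAlternatingMap.constOfIsEmpty ℝ E (Fin 0) c) _ = 0
  rw [extDeriv_constOfIsEmpty]
  ext u
  simp

/-- On a connected manifold a function with vanishing differential is constant. -/
theorem evalAt_eq_of_extD_eq_zero [ConnectedSpace M] {f : DiffForm E M 0} (h : extD E M 0 f = 0)
    (p q : M) : evalAt p f = evalAt q f := by
  have hloc : IsLocallyConstant fun x : M => evalAt x f := by
    rw [IsLocallyConstant.iff_eventually_eq]
    intro x₀
    set φ := extChartAt 𝓘(ℝ, E) x₀ with hφ
    have hd : ∀ y ∈ φ.target, fderiv ℝ (chartForm f.1 x₀) y = 0 := by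
      intro y hy
      have h0 := extDeriv_chartForm_eq_zero h x₀ hy
      ext a u
      rw [Subsingleton.elim u ![], ← extDeriv_one_apply, h0]
      rfl
    obtain ⟨r, hr, hball⟩ := Metric.mem_nhds_iff.1 (extChartAt_target_mem_nhds (I := 𝓘(ℝ, E)) x₀)
    have hmem : ∀ᶠ x in 𝓝 x₀, x ∈ φ.source ∧ φ x ∈ Metric.ball (φ x₀) r :=
      Filter.Eventually.and (extChartAt_source_mem_nhds (I := 𝓘(ℝ, E)) x₀)
        ((continuousAt_extChartAt x₀).eventually (Metric.ball_mem_nhds _ hr))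
    have hval : ∀ x ∈ φ.source, chartForm f.1 x₀ (φ x) ![] = evalAt x f := by
      intro x hx
      have e : ∀ z : M, z = x → evalAt z f = evalAt x f := by rintro _ rfl; rfl
      refine Eq.trans ?_ (e _ (φ.left_inv hx))
      exact congrArg (f.1 (φ.symm (φ x)) : (Fin 0 → E) → ℝ) (Subsingleton.elim _ _)
    filter_upwards [hmem] with x hx
    rw [← hval x hx.1, ← hval x₀ (mem_extChartAt_source x₀)]
    refine congrArg (fun g : E [⋀^Fin 0]→L[ℝ] ℝ => g ![]) ?_
    exact Metric.isOpen_ball.is_const_of_fderiv_eq_zero (convex_ball _ _).isPreconnected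
      (fun y hy => (chartForm_differentiableAt f x₀ (hball hy)).differentiableWithinAt)
      (fun y hy => hd y (hball hy)) hx.2 (Metric.mem_ball_self hr)
  exact hloc.apply_eq_of_preconnectedSpace p q

theorem DiffForm.eq_of_extD_eq [ConnectedSpace M] {f g : DiffForm E M 0}
    (h : extD E M 0 f = extD E M 0 g) (p : M) (hp : evalAt p f = evalAt p g) : f = g := by
  have h0 : extD E M 0 (f - g) = 0 := by rw [map_sub, h, sub_self]
  refine DiffForm.ext_evalAt fun q => ?_
  have h1 := evalAt_eq_of_extD_eq_zero h0 q p
  rwa [map_sub, map_sub, hp, sub_self, sub_eq_zero] at h1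

end Functions

/-! ### Evaluation at a point is a chain map -/

section ChainMap
variable {E M 𝔤 𝔥 : Type*} [NormedAddCommGroup E] [NormedSpace ℝ E]
  [TopologicalSpace M] [ChartedSpace E M] [IsManifold 𝓘(ℝ, E) ∞ M]
  [LieRing 𝔤] [LieAlgebra ℝ 𝔤]
  [AddCommGroup 𝔥] [Module ℝ 𝔥] [LieRingModule 𝔤 𝔥] [LieModule ℝ 𝔤 𝔥]

theorem evalR_totD (L : MinimalLie2Algebra 𝔤 𝔥) (p : M) (n : ℕ) (ξ : CTot E M 𝔤 𝔥 n) :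
    evalR p (n + 1) (totD L n ξ) = ceD L n (evalR p n ξ) :=
  Subtype.ext <| funext fun a => funext fun b => CEBi.map_ceTotD (evalAt p) L (ξ.1 0) a b

end ChainMap

/-! ### Moment maps as primitives -/

section MomentMaps
variable {E M 𝔤 𝔥 : Type*} [NormedAddCommGroup E] [NormedSpace ℝ E] [FiniteDimensional ℝ E]
  [TopologicalSpace M] [ChartedSpace E M] [IsManifold 𝓘(ℝ, E) ∞ M]
  [LieRing 𝔤] [LieAlgebra ℝ 𝔤]
  [AddCommGroup 𝔥] [Module ℝ 𝔥] [LieRingModule 𝔤 𝔥] [LieModule ℝ 𝔤 𝔥]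
  {L : MinimalLie2Algebra 𝔤 𝔥} {θ : DiffForm E M 3} {act : HamiltonianAction θ 𝔤}

/-- Only the component `ω_3` of `ω̃` consists of functions, so only it survives evaluation at `p`. -/
theorem evalR_omegaTilde (θ : DiffForm E M 3) (act : HamiltonianAction θ 𝔤) (p : M) :
    evalR p 3 (omegaTilde 𝔥 θ act) = omega3p 𝔥 θ act p := by
  refine Subtype.ext (funext fun a => funext fun b => ?_)
  by_cases h : a = 3 ∧ b = 0
  · obtain ⟨rfl, rfl⟩ := h
    have h1 : (omegaTilde 𝔥 θ act).1 0 3 0 = 0 + 0 + ceAlt 𝔥 (omega₃ θ act) := rfl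
    have h2 : (omega3p 𝔥 θ act p).1 3 0 = ceAlt 𝔥 (omega3pAlt θ act p) := rfl
    show CEBi.map (evalAt p) 3 0 ((omegaTilde 𝔥 θ act).1 0 3 0) = _
    rw [h1, h2, zero_add, zero_add]
    refine CEBi.ext_apply fun x u => ?_
    show θ.1 p _ = θ.1 p _
    congr 1
    funext i
    fin_cases i <;> rfl
  · have h1 : (omega3p 𝔥 θ act p).1 a b = 0 := by
      show CETot.single 3 0 _ a b = 0
      by_cases ha : a = 3
      · subst ha
        have hb : b ≠ 0 := fun hb => h ⟨rfl, hb⟩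
        simp [CETot.single, hb]
      · simp [CETot.single, ha]
    rw [h1]
    show CEBi.map (evalAt p) a b ((omegaTilde 𝔥 θ act).1 0 a b) = 0
    by_cases h2 : a = 1 ∧ b = 1
    · obtain ⟨rfl, rfl⟩ := h2
      have h3 : (omegaTilde 𝔥 θ act).1 0 1 1 = 0 + 0 + 0 := rfl
      rw [h3, zero_add, zero_add, map_zero]
    · rw [(omegaTilde 𝔥 θ act).2 0 a b (by omega), map_zero]

/-- By nondegeneracy, the chosen Hamiltonian vector field is the given one. -/
theorem hamVF_eq (hθ : IsTwoPlectic θ) (α : HamForm θ) {X : VF E M}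
    (h : IsHamiltonianFor θ α X) : hamVF θ α = X := by
  have h1 : contract (hamVF θ α) 2 θ = contract X 2 θ :=
    neg_injective ((Classical.choose_spec α.2).symm.trans h)
  refine ContMDiffSection.ext fun p => hθ.2 p ?_
  exact congrFun (congrArg Subtype.val h1) p

theorem HamiltonianAction.extD_contract (act : HamiltonianAction θ 𝔤) (x : 𝔤) :
    extD E M 2 (contract (act.v x) 2 θ) = 0 := by
  obtain ⟨α, hα⟩ := act.hamiltonian x
  have h : contract (act.v x) 2 θ = -extD E M 1 α := by
    rw [show extD E M 1 α = -contract (act.v x) 2 θ from hα, neg_neg]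
  rw [h, map_neg, extD_extD, neg_zero]

theorem HamiltonianAction.isLieBracket (act : HamiltonianAction θ 𝔤) (x y : 𝔤) :
    IsLieBracket (act.v ⁅x, y⁆) (act.v x) (act.v y) := act.map_lie x y

theorem omega₂_apply (x y : 𝔤) :
    omega₂ θ act ![x, y] = contract (act.v y) 1 (contract (act.v x) 2 θ) := rfl

theorem omega₃_apply (x y z : 𝔤) : omega₃ θ act ![x, y, z] =
    contract (act.v z) 0 (contract (act.v y) 1 (contract (act.v x) 2 θ)) := rfl

theorem extD_omega₂ (hθ : IsTwoPlectic θ) (x y : 𝔤) :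
    extD E M 1 (omega₂ θ act ![x, y]) = -contract (act.v ⁅x, y⁆) 2 θ := by
  rw [contract_isLieBracket hθ.1 (act.isLieBracket x y) (act.extD_contract x)
    (act.extD_contract y), neg_neg, omega₂_apply]

/-- In other words, `d ω_3` is the Chevalley-Eilenberg differential of `-ω_2`. -/
theorem extD_omega₃ (hθ : IsTwoPlectic θ) (x y z : 𝔤) :
    extD E M 0 (omega₃ θ act ![x, y, z]) = -(omega₂ θ act ![x, ⁅y, z⁆]
      - omega₂ θ act ![y, ⁅x, z⁆] + omega₂ θ act ![z, ⁅x, y⁆]) :=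
  extD_contract₃ hθ.1 (act.isLieBracket x y) (act.isLieBracket x z) (act.isLieBracket y z)
    (act.extD_contract x) (act.extD_contract y) (act.extD_contract z)

theorem bracket₂_eq (hθ : IsTwoPlectic θ) {f : 𝔤 → HamForm θ}
    (hf : ∀ x, IsHamiltonianFor θ (f x : DiffForm E M 1) (act.v x)) (x y : 𝔤) :
    bracket₂ θ (f x) (f y) = omega₂ θ act ![x, y] := by
  rw [bracket₂, hamVF_eq hθ _ (hf x), hamVF_eq hθ _ (hf y), omega₂_apply]

theorem bracket₃_eq (hθ : IsTwoPlectic θ) {f : 𝔤 → HamForm θ}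
    (hf : ∀ x, IsHamiltonianFor θ (f x : DiffForm E M 1) (act.v x)) (x y z : 𝔤) :
    bracket₃ θ (f x) (f y) (f z) = -omega₃ θ act ![x, y, z] := by
  rw [bracket₃, hamVF_eq hθ _ (hf x), hamVF_eq hθ _ (hf y), hamVF_eq hθ _ (hf z), omega₃_apply]

theorem exists_vec₂ {α : Type*} (u : Fin 2 → α) : ∃ a b, u = ![a, b] :=
  ⟨u 0, u 1, by ext i; fin_cases i <;> rfl⟩

theorem exists_vec₃ {α : Type*} (u : Fin 3 → α) : ∃ a b c, u = ![a, b, c] :=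
  ⟨u 0, u 1, u 2, by ext i; fin_cases i <;> rfl⟩

theorem exists_vec₄ {α : Type*} (u : Fin 4 → α) : ∃ a b c d, u = ![a, b, c, d] :=
  ⟨u 0, u 1, u 2, u 3, by ext i; fin_cases i <;> rfl⟩

theorem ceAlt_apply {N : Type*} [AddCommGroup N] [Module ℝ N] {p : ℕ} (f : 𝔤 [⋀^Fin p]→ₗ[ℝ] N)
    (x : Fin p → 𝔤) : ceAlt 𝔥 f x = SymForm.const (f x) := rfl

/-- A moment map, seen as an element of `C²`, is a primitive of `ω̃`. -/
theorem MomentMap.totD_toC (hθ : IsTwoPlectic θ) (φ : MomentMap L θ act) :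
    totD L 2 φ.toC = omegaTilde 𝔥 θ act := by
  refine Subtype.ext (funext fun j => funext fun p => funext fun q => ?_)
  by_cases h : p + 2 * q + j ≠ 3 ∨ p + 2 * q = 0
  · rw [(totD L 2 φ.toC).2 j p q h, (omegaTilde 𝔥 θ act).2 j p q h]
  have h0 := φ.toC.2
  -- each summand is supported in a single component, and evaluates there by definition
  have hf₁ : φ.toC.1 1 1 0 = ceAlt 𝔥 (AlternatingMap.ofSubsingleton ℝ 𝔤 (DiffForm E M 1)
      (0 : Fin 1) ((HamForm θ).subtype ∘ₗ φ.f₁)) + 0 + 0 := rfl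
  have hf₁h : φ.toC.1 0 0 1 = 0 + ceLin 𝔤 φ.f₁h + 0 := rfl
  have hf₂ : φ.toC.1 0 2 0 = 0 + 0 + ceAlt 𝔥 φ.f₂ := rfl
  rw [add_zero, add_zero] at hf₁
  rw [zero_add, add_zero] at hf₁h
  rw [zero_add, zero_add] at hf₂
  -- the components `(j, p, q)` of total degree `3` with `p + 2 q ≠ 0`
  obtain ⟨rfl, rfl, rfl⟩ | ⟨rfl, rfl, rfl⟩ | ⟨rfl, rfl, rfl⟩ | ⟨rfl, rfl, rfl⟩ | ⟨rfl, rfl, rfl⟩ :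
      (j = 2 ∧ p = 1 ∧ q = 0) ∨ (j = 1 ∧ p = 2 ∧ q = 0) ∨ (j = 1 ∧ p = 0 ∧ q = 1) ∨
        (j = 0 ∧ p = 3 ∧ q = 0) ∨ (j = 0 ∧ p = 1 ∧ q = 1) := by omega
  · have hr : (omegaTilde 𝔥 θ act).1 2 1 0 = ceAlt 𝔥 (omega₁ θ act) + 0 + 0 := rfl
    have hl : (totD L 2 φ.toC).1 2 1 0 = (ceAct 0 0 (φ.toC.1 2 0 0) + ceBracket 0 0 (φ.toC.1 2 0 0))
      + (-1 : ℝ) ^ 1 • CEBi.map (extD E M 1) 1 0 (φ.toC.1 1 1 0) := rfl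
    rw [hl, hr, hf₁, h0 2 0 0 (by omega)]
    simp only [map_zero, add_zero, zero_add, pow_one]
    refine CEBi.ext_apply fun x u => ?_
    show (-1 : ℝ) • extD E M 1 (φ.f₁ (x 0) : DiffForm E M 1) = contract (act.v (x 0)) 2 θ
    rw [show extD E M 1 (φ.f₁ (x 0) : DiffForm E M 1) = _ from φ.moment (x 0), neg_one_smul,
      neg_neg]
  · have hr : (omegaTilde 𝔥 θ act).1 1 2 0 = 0 + ceAlt 𝔥 (-omega₂ θ act) + 0 := rfl
    have hl : (totD L 2 φ.toC).1 1 2 0 = (ceAct 1 0 (φ.toC.1 1 1 0) + ceBracket 0 1 (φ.toC.1 1 1 0))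
      + (-1 : ℝ) ^ 2 • CEBi.map (extD E M 0) 2 0 (φ.toC.1 0 2 0) := rfl
    rw [hl, hr, hf₁, hf₂, ceAct_right_zero]
    simp only [add_zero, zero_add, even_two, Even.neg_pow, one_pow, one_smul]
    ext1 x
    obtain ⟨x, y, rfl⟩ := exists_vec₂ x
    rw [AlternatingMap.add_apply, ceBracket_one_apply, CEBi.map_apply, ceAlt_apply, ceAlt_apply,
      ceAlt_apply, AlternatingMap.neg_apply, ← bracket₂_eq hθ φ.moment]
    have h1 : SymForm.map (extD E M 0) 0 (SymForm.const (φ.f₂ ![x, y])) =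
      SymForm.const (𝔥 := 𝔥) (extD E M 0 (φ.f₂ ![x, y])) := rfl
    rw [h1, φ.d_f₂, map_sub, map_neg]
    show -SymForm.const (φ.f₁ ⁅x, y⁆ : DiffForm E M 1) + _ = _
    rw [neg_add_eq_sub, sub_sub_cancel_left]
  · have hr : (omegaTilde 𝔥 θ act).1 1 0 1 = 0 + 0 + 0 := rfl
    have hl : (totD L 2 φ.toC).1 1 0 1 = 0
      + (-1 : ℝ) ^ 2 • CEBi.map (extD E M 0) 0 1 (φ.toC.1 0 0 1) := rfl
    rw [hl, hr, hf₁h]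
    simp only [add_zero, zero_add, even_two, Even.neg_pow, one_pow, one_smul]
    exact CEBi.ext_apply fun x u => φ.d_f₁h (u 0)
  · have hr : (omegaTilde 𝔥 θ act).1 0 3 0 = 0 + 0 + ceAlt 𝔥 (omega₃ θ act) := rfl
    have hl : (totD L 2 φ.toC).1 0 3 0 = ceAct 2 0 (φ.toC.1 0 2 0) + ceBracket 0 2 (φ.toC.1 0 2 0)
      + ceTriple L 0 0 (φ.toC.1 0 0 1) := rfl
    rw [hl, hr, hf₂, hf₁h, ceAct_right_zero]
    simp only [zero_add]
    ext1 x
    obtain ⟨x, y, z, rfl⟩ := exists_vec₃ x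
    rw [AlternatingMap.add_apply, ceBracket_two_apply, ceTriple_zero_apply]
    simp only [ceAlt_apply]
    have h1 : SymForm.insert 0 (L.triple ![x, y, z]) (ceLin 𝔤 φ.f₁h ![]) =
      SymForm.const (φ.f₁h (L.triple ![x, y, z])) := rfl
    have h2 := φ.f₁h_triple x y z
    rw [bracket₃_eq hθ φ.moment] at h2
    have h3 : omega₃ θ act ![x, y, z] = φ.f₂ ![x, ⁅y, z⁆] - φ.f₂ ![y, ⁅x, z⁆] + φ.f₂ ![z, ⁅x, y⁆]
        + -φ.f₁h (L.triple ![x, y, z]) := by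
      rw [← h2]
      abel
    rw [h1, h3]
    simp only [map_add, map_sub, map_neg]
  · have hr : (omegaTilde 𝔥 θ act).1 0 1 1 = 0 + 0 + 0 := rfl
    have hl : (totD L 2 φ.toC).1 0 1 1 =
      ceAct 0 1 (φ.toC.1 0 0 1) + 0 := rfl
    rw [hl, hr, hf₁h]
    simp only [add_zero]
    refine CEBi.ext_apply fun x u => ?_
    rw [ceAct_zero_one_apply]
    show -φ.f₁h ⁅x 0, u 0⁆ = 0
    rw [φ.f₁h_lie, neg_zero]

/-- For the trivial action on the coefficients, the differential of `ω_{3p}` consists of the bracket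
terms alone, and these cancel by `isLieBracket_cocycle`. -/
theorem ceD_omega3p (L : MinimalLie2Algebra 𝔤 𝔥) (hθ : IsTwoPlectic θ)
    (act : HamiltonianAction θ 𝔤) (p : M) : ceD L 3 (omega3p 𝔥 θ act p) = 0 := by
  refine Subtype.ext (funext fun a => funext fun b => ?_)
  by_cases h : a + 2 * b ≠ 4
  · exact (ceD L 3 (omega3p 𝔥 θ act p)).2 a b (Or.inl h)
  obtain ⟨rfl, rfl⟩ | ⟨rfl, rfl⟩ | ⟨rfl, rfl⟩ :
      (a = 4 ∧ b = 0) ∨ (a = 2 ∧ b = 1) ∨ (a = 0 ∧ b = 2) := by omega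
  · have hl : (ceD L 3 (omega3p 𝔥 θ act p)).1 4 0 = ceAct 3 0 (ceAlt 𝔥 (omega3pAlt θ act p))
      + ceBracket 0 3 (ceAlt 𝔥 (omega3pAlt θ act p)) + ceTriple L 1 0 0 := rfl
    rw [hl, ceAct_right_zero, map_zero, zero_add, add_zero]
    ext1 x
    obtain ⟨x, y, z, w, rfl⟩ := exists_vec₄ x
    rw [ceBracket_three_apply]
    simp only [ceAlt_apply]
    have h1 := isLieBracket_cocycle hθ.1 (act.isLieBracket x y) (act.isLieBracket x z)
      (act.isLieBracket x w) (act.isLieBracket y z) (act.isLieBracket y w) (act.isLieBracket z w)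
      (act.extD_contract x) (act.extD_contract y) (act.extD_contract z) (act.extD_contract w) p
    have h2 : ∀ a b c : 𝔤, θ.1 p ![act.v a p, act.v b p, act.v c p] =
        omega3pAlt θ act p ![a, b, c] := by
      intro a b c
      show θ.1 p _ = θ.1 p _
      congr 1
      funext i
      fin_cases i <;> rfl
    simp only [h2] at h1
    refine Eq.trans ?_ (map_zero SymForm.const)
    rw [← h1]
    simp only [map_add, map_sub, map_neg]
  · have hl : (ceD L 3 (omega3p 𝔥 θ act p)).1 2 1 = ceAct 1 1 0 + ceBracket 1 1 0 := rfl
    rw [hl, map_zero, map_zero, add_zero]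
    rfl
  · rfl

theorem Coh.mk_eq_zero_iff {A B C : Type*} [AddCommGroup A] [Module ℝ A] [AddCommGroup B]
    [Module ℝ B] [AddCommGroup C] [Module ℝ C] (f : A →ₗ[ℝ] B) (g : B →ₗ[ℝ] C) (x : B)
    (hx : g x = 0) : Coh.mk f g x hx = 0 ↔ ∃ a, f a = x := by
  rw [Coh.mk, Submodule.Quotient.mk_eq_zero]
  rfl

end MomentMaps

/-! ### Existence of moment maps -/

section Existence
variable {E M 𝔤 𝔥 : Type*} [NormedAddCommGroup E] [NormedSpace ℝ E] [FiniteDimensional ℝ E]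
  [TopologicalSpace M] [ChartedSpace E M] [IsManifold 𝓘(ℝ, E) ∞ M]
  [LieRing 𝔤] [LieAlgebra ℝ 𝔤]
  [AddCommGroup 𝔥] [Module ℝ 𝔥] [LieRingModule 𝔤 𝔥] [LieModule ℝ 𝔤 𝔥]
  {L : MinimalLie2Algebra 𝔤 𝔥} {θ : DiffForm E M 3} {act : HamiltonianAction θ 𝔤}

variable (𝔤) in
/-- The bracket of a Lie algebra as an alternating map. -/
def lieAlt : 𝔤 [⋀^Fin 2]→ₗ[ℝ] 𝔤 where
  toFun x := ⁅x 0, x 1⁆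
  map_update_add' := by
    intro inst x i a b
    obtain rfl : inst = instDecidableEqFin _ := Subsingleton.elim _ _
    match i with
    | 0 => simp
    | 1 => simp
  map_update_smul' := by
    intro inst x i c a
    obtain rfl : inst = instDecidableEqFin _ := Subsingleton.elim _ _
    match i with
    | 0 => simp
    | 1 => simp
  map_eq_zero_of_eq' := by
    intro x i j h hij
    have h01 : x 0 = x 1 := by
      fin_cases i <;> fin_cases j <;> simp_all
    rw [h01, lie_self]

/-- Primitives of the forms `-ι_{v_x} θ` can be chosen to depend linearly on `x`. -/
theorem HamiltonianAction.exists_linear_primitive (act : HamiltonianAction θ 𝔤) :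
    ∃ f : 𝔤 →ₗ[ℝ] DiffForm E M 1, ∀ x, IsHamiltonianFor θ (f x) (act.v x) := by
  let A : 𝔤 →ₗ[ℝ] DiffForm E M 2 :=
    { toFun := fun x => -contract (act.v x) 2 θ
      map_add' := fun x y => by rw [map_add, contract_add_left, neg_add]
      map_smul' := fun c x => by rw [map_smul, contract_smul_left, smul_neg, RingHom.id_apply] }
  have hA : ∀ x, A x ∈ LinearMap.range (extD E M 1) := act.hamiltonian
  obtain ⟨s, hs⟩ := (extD E M 1).rangeRestrict.exists_rightInverse_of_surjective
    (LinearMap.range_rangeRestrict _)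
  refine ⟨s ∘ₗ A.codRestrict _ hA, fun x => ?_⟩
  exact congrArg Subtype.val (LinearMap.congr_fun hs ⟨A x, hA x⟩)

/-- If `H¹(M) = 0`, then a function can be recovered linearly from its differential and its value at
`p`. -/
theorem exists_section_extD_evalAt [Subsingleton (DeRhamH1 E M)] (p : M) :
    ∃ s : LinearMap.ker (extD E M 1) × ℝ →ₗ[ℝ] DiffForm E M 0,
      ∀ a, extD E M 0 (s a) = a.1 ∧ evalAt p (s a) = a.2 := by
  -- `H¹(M) = 0` and the constants make this map surjective; the section is a linear right inverse
  let P : DiffForm E M 0 →ₗ[ℝ] LinearMap.ker (extD E M 1) × ℝ :=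
    ((extD E M 0).codRestrict (LinearMap.ker (extD E M 1)) fun f => extD_extD 0 f).prod (evalAt p)
  have hP : LinearMap.range P = ⊤ := by
    rw [LinearMap.range_eq_top]
    rintro ⟨⟨α, hα⟩, c⟩
    obtain ⟨g, hg⟩ := (Coh.mk_eq_zero_iff (extD E M 0) (extD E M 1) α hα).1
      (Subsingleton.elim (α := DeRhamH1 E M) _ _)
    refine ⟨g + constFun E M (c - evalAt p g), Prod.ext (Subtype.ext ?_) ?_⟩
    · show extD E M 0 (g + constFun E M (c - evalAt p g)) = α
      rw [map_add, extD_constFun, hg, add_zero]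
    · show evalAt p (g + constFun E M (c - evalAt p g)) = c
      rw [map_add, evalAt_constFun, add_sub_cancel]
  obtain ⟨s, hs⟩ := P.exists_rightInverse_of_surjective hP
  refine ⟨s, fun a => ?_⟩
  have h : P (s a) = a := LinearMap.congr_fun hs a
  exact ⟨congrArg (fun b => (b.1 : DiffForm E M 1)) h, congrArg Prod.snd h⟩

/-- The components `b` and `e` of a primitive of `ω_{3p}` determine a moment map: `f₁` on `𝔥` is `e`,
with values in the constants, and `f₂` is the primitive of `f₁([x, y]) - ω_2(x, y)` whose value at `p`
is `b`. -/
theorem exists_momentMap [ConnectedSpace M] [Subsingleton (DeRhamH1 E M)] (hθ : IsTwoPlectic θ)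
    (p : M) (b : 𝔤 [⋀^Fin 2]→ₗ[ℝ] ℝ) (e : 𝔥 →ₗ[ℝ] ℝ) (he : ∀ (x : 𝔤) (h : 𝔥), e ⁅x, h⁆ = 0)
    (hbe : ∀ x y z, b ![x, ⁅y, z⁆] - b ![y, ⁅x, z⁆] + b ![z, ⁅x, y⁆] - e (L.triple ![x, y, z]) =
      omega3pAlt θ act p ![x, y, z]) : Nonempty (MomentMap L θ act) := by
  obtain ⟨f, hf⟩ := act.exists_linear_primitive
  obtain ⟨s, hs⟩ := exists_section_extD_evalAt (E := E) p
  let B : 𝔤 [⋀^Fin 2]→ₗ[ℝ] DiffForm E M 1 := f.compAlternatingMap (lieAlt 𝔤) - omega₂ θ act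
  have hB : ∀ x y, B ![x, y] = f ⁅x, y⁆ - omega₂ θ act ![x, y] := fun _ _ => rfl
  have hB0 : ∀ x, B x ∈ LinearMap.ker (extD E M 1) := by
    intro x
    obtain ⟨x, y, rfl⟩ := exists_vec₂ x
    rw [LinearMap.mem_ker, hB, map_sub, extD_omega₂ hθ,
      show extD E M 1 (f ⁅x, y⁆) = _ from hf ⁅x, y⁆, sub_self]
  let f₂ : 𝔤 [⋀^Fin 2]→ₗ[ℝ] DiffForm E M 0 :=
    s.compAlternatingMap ((B.codRestrict _ hB0).prod b)
  have hd : ∀ x y, extD E M 0 (f₂ ![x, y]) = f ⁅x, y⁆ - omega₂ θ act ![x, y] :=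
    fun x y => (hs _).1
  have hv : ∀ x y, evalAt p (f₂ ![x, y]) = b ![x, y] := fun x y => (hs _).2
  let f₁ : 𝔤 →ₗ[ℝ] HamForm θ := f.codRestrict (HamForm θ) fun x => ⟨act.v x, hf x⟩
  have hf₁ : ∀ x, IsHamiltonianFor θ (f₁ x : DiffForm E M 1) (act.v x) := hf
  refine ⟨⟨f₁, constFun E M ∘ₗ e, f₂, hf₁, fun h => extD_constFun _, fun x y => ?_, fun x h => ?_,
    fun x y z => ?_⟩⟩
  · rw [bracket₂_eq hθ hf₁]
    exact hd x y
  · rw [LinearMap.comp_apply, he, map_zero]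
  -- both sides have the same differential by the Jacobi identity, and the same value at `p`
  · rw [bracket₃_eq hθ hf₁, sub_neg_eq_add, LinearMap.comp_apply]
    refine DiffForm.eq_of_extD_eq ?_ p ?_
    · have hJ : f ⁅x, ⁅y, z⁆⁆ - f ⁅y, ⁅x, z⁆⁆ + f ⁅z, ⁅x, y⁆⁆ = 0 := by
        rw [← map_sub, ← map_add, leibniz_lie x y z, add_sub_cancel_right, ← lie_skew z ⁅x, y⁆,
          add_neg_cancel, map_zero]
      have h0 : extD E M 0 (constFun E M (e (L.triple ![x, y, z])) + omega₃ θ act ![x, y, z]) =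
          -(omega₂ θ act ![x, ⁅y, z⁆] - omega₂ θ act ![y, ⁅x, z⁆] + omega₂ θ act ![z, ⁅x, y⁆]) := by
        rw [map_add, extD_constFun, extD_omega₃ hθ]
        exact zero_add _
      rw [h0, map_add, map_sub, hd, hd, hd, ← zero_sub, ← hJ]
      abel
    · have h3 : evalAt p (omega₃ θ act ![x, y, z]) = omega3pAlt θ act p ![x, y, z] := by
        show θ.1 p _ = θ.1 p _
        congr 1
        funext i
        fin_cases i <;> rfl
      rw [map_add, evalAt_constFun, h3, ← hbe, map_add, map_sub, hv, hv, hv, add_sub_cancel]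

theorem nonempty_momentMap_of_exact [ConnectedSpace M] [Subsingleton (DeRhamH1 E M)]
    (hθ : IsTwoPlectic θ) (p : M) (η : CE 𝔤 𝔥 ℝ 2) (hη : ceD L 2 η = omega3p 𝔥 θ act p) :
    Nonempty (MomentMap L θ act) := by
  -- the components of bidegree `(1, 1)` and `(3, 0)` of `hη` are the two conditions on `b` and `e`
  let ev : SymForm 𝔥 ℝ 0 →ₗ[ℝ] ℝ :=
    { toFun := fun f => f.1 ![]
      map_add' := fun _ _ => rfl
      map_smul' := fun _ _ => rfl }
  have h11 : ceAct 0 1 (η.1 0 1) = 0 := by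
    have h := congrArg (fun ξ : CE 𝔤 𝔥 ℝ 3 => ξ.1 1 1) hη
    have hl : (ceD L 2 η).1 1 1 = ceAct 0 1 (η.1 0 1) + 0 := rfl
    rw [add_zero] at hl
    exact hl.symm.trans h
  have h30 : ceBracket 0 2 (η.1 2 0) + ceTriple L 0 0 (η.1 0 1) =
      ceAlt 𝔥 (omega3pAlt θ act p) := by
    have h := congrArg (fun ξ : CE 𝔤 𝔥 ℝ 3 => ξ.1 3 0) hη
    have hl : (ceD L 2 η).1 3 0 =
      ceAct 2 0 (η.1 2 0) + ceBracket 0 2 (η.1 2 0) + ceTriple L 0 0 (η.1 0 1) := rfl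
    rw [ceAct_right_zero] at hl
    simp only [zero_add] at hl
    exact hl.symm.trans h
  refine exists_momentMap hθ p (ev.compAlternatingMap (η.1 2 0))
    (ev ∘ₗ (SymForm.insert 0).flip (η.1 0 1 ![])) (fun x h => ?_) (fun x y z => ?_)
  · have h1 := ceAct_zero_one_apply (η.1 0 1) ![x] ![h]
    rw [h11] at h1
    exact (neg_eq_zero.1 h1.symm)
  · have h1 := congrArg (fun ξ : CEBi 𝔤 𝔥 ℝ 3 0 => ev (ξ ![x, y, z])) h30
    simp only [AlternatingMap.add_apply, ceBracket_two_apply, ceTriple_zero_apply, map_add]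
      at h1
    exact h1

end Existence
end LieTwoMoment

end

open LieTwoMoment

theorem mainTheorem3 {E M 𝔤 𝔥 : Type*}
    [NormedAddCommGroup E] [NormedSpace ℝ E] [FiniteDimensional ℝ E]
    [TopologicalSpace M] [ChartedSpace E M] [IsManifold 𝓘(ℝ, E) ∞ M]
    [T2Space M] [SecondCountableTopology M]
    [LieRing 𝔤] [LieAlgebra ℝ 𝔤] [FiniteDimensional ℝ 𝔤]
    [AddCommGroup 𝔥] [Module ℝ 𝔥] [LieRingModule 𝔤 𝔥] [LieModule ℝ 𝔤 𝔥] [FiniteDimensional ℝ 𝔥]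
    (L : MinimalLie2Algebra 𝔤 𝔥)
    (θ : DiffForm E M 3) (hθ : IsTwoPlectic θ) (act : HamiltonianAction θ 𝔤) (p : M) :
    -- `r` is a chain map which sends `ω̃` to `ω_{3p}`
    (∀ (n : ℕ) (ξ : CTot E M 𝔤 𝔥 n), evalR p (n + 1) (totD L n ξ) = ceD L n (evalR p n ξ)) ∧
    evalR p 3 (omegaTilde 𝔥 θ act) = omega3p 𝔥 θ act p ∧
    -- a moment map, seen in `C²`, is a primitive of `ω̃`; its image under `r` is one of `ω_{3p}`
    (∀ φ : MomentMap L θ act, totD L 2 φ.toC = omegaTilde 𝔥 θ act ∧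
      ceD L 2 (evalR p 2 φ.toC) = omega3p 𝔥 θ act p) ∧
    -- necessity and sufficiency of the vanishing of the class of `ω_{3p}`
    ∃ hcl : ceD L 3 (omega3p 𝔥 θ act p) = 0,
      (Nonempty (MomentMap L θ act) →
        CEH3.mk L (omega3p 𝔥 θ act p) hcl = 0) ∧
      (ConnectedSpace M → Subsingleton (DeRhamH1 E M) →
        CEH3.mk L (omega3p 𝔥 θ act p) hcl = 0 →
        Nonempty (MomentMap L θ act)) := by
  have hφ : ∀ φ : MomentMap L θ act, ceD L 2 (evalR p 2 φ.toC) = omega3p 𝔥 θ act p := fun φ => by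
    rw [← evalR_totD, φ.totD_toC hθ, evalR_omegaTilde]
  refine ⟨evalR_totD L p, evalR_omegaTilde θ act p, fun φ => ⟨φ.totD_toC hθ, hφ φ⟩,
    ceD_omega3p L hθ act p, fun ⟨φ⟩ => ?_, fun _ _ h => ?_⟩
  · exact (Coh.mk_eq_zero_iff _ _ _ _).2 ⟨_, hφ φ⟩
  · obtain ⟨η, hη⟩ := (Coh.mk_eq_zero_iff _ _ _ _).1 h
    exact nonempty_momentMap_of_exact hθ p η hη
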